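/- **Setting.** For each sample size $n$ we observe $Y_i=f_n(x_i)+\varepsilon_i$, $i=1,\dots,n$, with fixed design points $x_i$ (which may change with $n$) and $\varepsilon_1,\dots,\varepsilon_n$ independent $N(0,\sigma^2)$, $\sigma>0$. Let $\Gamma_n$ be a countable list of candidate models; model $k\in\Gamma_n$ is a finite-dimensional linear space $\mathcal F_k$ of regression functions. Write $\mathbf Y_n=(Y_i)$, $\mathbf f_n=(f_n(x_i))\in\mathbb R^n$, let $M_k$ be the orthogonal projection of $\mathbb R^n$ onto $\{(g(x_i))_{i\le n}: g\in\mathcal F_k\}$, and let $r_k$ be its rank. Let $S_1(k)$ be the set of $k'\in\Gamma_n$ with $\mathcal F_{k'}\subseteq\mathcal F_k$ and $r_{k'}=r_k-1$; it is assumed non-empty whenever $r_k>1$. Fix $\lambda_n\ge(\log n)^{-1}$ (for $n\ge2$) and $d\ge0$, and for $s^2\in\mathbb R$ put $$IC(k;s^2)=\|\mathbf Y_n-M_k\mathbf Y_n\|^2+\lambda_n\log(n)\,r_k s^2-ns^2+d\,n^{1/2}\log(n)\,s^2 .$$ Let $\hat k_n\in\Gamma_n$ be the (random) selected model. The parametricness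 index for known $\sigma$ is $$\mathrm{PI}_n=\inf_{k\in S_1(\hat k_n)}\frac{IC(k;\sigma^2)}{IC(\hat k_n;\sigma^2)}\ \text{ if } r_{\hat k_n}>1,\qquad \mathrm{PI}_n=n\ \text{ otherwise},$$ and $\widehat{\mathrm{PI}}_n$ is defined in the same way with $\sigma^2$ replaced by $\hat\sigma_n^2=\|\mathbf Y_n-M_{\hat k_n}\mathbf Y_n\|^2/(n-r_{\hat k_n})$. Assume that $\Gamma_n$ contains models whose dimensions tend to $\infty$ with $n$. **Parametric scenario.** For all large $n$, $f_n\in\mathcal F_{k_n^*}$ for some $k_n^*\in\Gamma_n$ with $r_{k_n^*}>1$, and the selection method is consistent: $P(\hat k_n=k_n^*)\to1$. Let $A_n=\inf_{k\in S_1(k_n^*)}\|(I-M_k)\mathbf f_n\|^2/\sigma^2$. There is $0<\tau\le\frac12$ such that - (P1) $A_n\ge c\,n^{1/2+\tau}$ for some $c>0$ and all large $n$; - (P2) $r_{k_n^*}\lambda_n\log n=o(n^{1/2+\tau})$. **Nonparametric scenario.** For all large $n$, $f_n\notin\mathcal F_k$ for all $k\in\Gamma_n$. Put $D_k=(\lambda_n\log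 n-1)r_k+\|(I-M_k)\mathbf f_n\|^2/\sigma^2+d\,n^{1/2}\log n$, $B_{j,n}=\inf\{D_k: k\in\Gamma_n,\ r_k=j\}$, $N_j=\#\{k\in\Gamma_n:r_k=j\}$ and $L_j=\sup\{\#S_1(k):k\in\Gamma_n,\ r_k=j\}$. There are integers $a_n\to\infty$ and $b_n$, with $1\le a_n<b_n<n$ for all large $n$, such that - (N1) $P(a_n\le r_{\hat k_n}\le b_n)\to1$ and $\sup_{a_n\le j\le b_n}B_{j,n}/(n-j)\to0$; - (N2) for some positive $\zeta_n\to0$ and some $c_0>0$, for all large $n$ and all $a_n\le j\le b_n$, $N_jL_j\le c_0e^{\zeta_nB_{j,n}}$ and $N_j\le c_0e^{B_{j,n}^2/(10(n-j))}$; and $\sum_{j=a_n}^{b_n}e^{-B_{j,n}^2/(10(n-j))}\to0$; - (N3) $\displaystyle\sup_{k:\,a_n\le r_k\le b_n}\ \inf_{k'\in S_1(k)}\frac{\|(M_k-M_{k'})\mathbf f_n\|^2}{D_k}\to0$. **Corollary.** $\mathrm{PI}_n$ has distinct limits in probability in the two scenarios. 1. In the parametric scenario $|\mathrm{PI}_n|\to\infty$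 in probability. Moreover $\mathrm{PI}_n\to+\infty$ in probability whenever $\{(\lambda_n\log n-1)r_{k_n^*}+d\,n^{1/2}\log n\}/n^{1/2}\to\infty$, in particular whenever $d>0$. For the index with estimated variance, $\widehat{\mathrm{PI}}_n\to+\infty$ in probability, provided $\lambda_n\log n>1$ or $d>0$ for all large $n$. 2. In the nonparametric scenario $\mathrm{PI}_n\to1$ in probability. -/

import Mathlib

open MeasureTheory ProbabilityTheory Filter Topology
open scoped ENNReal

noncomputable section

namespace ParamIndex

/-- Evaluation of a function at the design points `x₁, …, xₙ`, as a vector of the Euclidean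
space `ℝⁿ`. -/
def evalAt {𝒳 : Type*} {n : ℕ} (x : Fin n → 𝒳) :
    (𝒳 → ℝ) →ₗ[ℝ] EuclideanSpace ℝ (Fin n) :=
  (WithLp.linearEquiv 2 ℝ (Fin n → ℝ)).symm.toLinearMap ∘ₗ LinearMap.funLeft ℝ ℝ x

/-- The column space in `ℝⁿ` of a linear family `F` of regression functions at the design `x`. -/
def colSpace {𝒳 : Type*} {n : ℕ} (x : Fin n → 𝒳) (F : Submodule ℝ (𝒳 → ℝ)) :
    Submodule ℝ (EuclideanSpace ℝ (Fin n)) :=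
  F.map (evalAt x)

/-- The rank `r_k` of the projection matrix of a model, i.e. the dimension of its column space. -/
def modelRank {𝒳 : Type*} {n : ℕ} (x : Fin n → 𝒳) (F : Submodule ℝ (𝒳 → ℝ)) : ℕ :=
  Module.finrank ℝ (colSpace x F)

/-- `S₁(k)`: the candidates whose family of functions is contained in that of model `k` and whose
rank is smaller by exactly one. -/
def subModels {𝒳 Γ : Type*} {n : ℕ} (x : Fin n → 𝒳) (F : Γ → Submodule ℝ (𝒳 → ℝ)) (k : Γ) :
    Set Γ :=
  {k' | F k' ≤ F k ∧ modelRank x (F k') + 1 = modelRank x (F k)}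

/-- Fixed-design Gaussian regression with a countable list `Γ n` of linear candidate models at each
sample size `n`, a data-dependent selected model, and the tuning constants of the index.
The design, the list and the regression function may all change with the sample size. -/
structure Setting {Ω : Type*} [MeasurableSpace Ω] (P : Measure Ω) (𝒳 : Type*)
    (Γ : ℕ → Type*) where
  /-- the design points `x₁, …, xₙ` at sample size `n` -/
  design : (n : ℕ) → Fin n → 𝒳
  /-- the family of regression functions of each candidate model -/
  model : (n : ℕ) → Γ n → Submodule ℝ (𝒳 → ℝ)
  /-- the true regression function -/
  truth : ℕ → 𝒳 → ℝ
  /-- the errors `ε₁, …, εₙ` at sample size `n` -/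
  noise : (n : ℕ) → Fin n → Ω → ℝ
  /-- the standard deviation of the errors -/
  sigma : ℝ
  /-- the sequence `λₙ` -/
  lam : ℕ → ℝ
  /-- the constant `d` -/
  d : ℝ
  /-- the selected model -/
  selected : (n : ℕ) → Ω → Γ n
  model_finite : ∀ n k, FiniteDimensional ℝ (model n k)
  sigma_pos : 0 < sigma
  noise_law : ∀ n i, HasLaw (noise n i) (gaussianReal 0 (sigma ^ 2).toNNReal) P
  noise_indep : ∀ n, iIndepFun (noise n) P
  lam_ge : ∀ n : ℕ, 2 ≤ n → (Real.log (n : ℝ))⁻¹ ≤ lam n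
  d_nonneg : 0 ≤ d
  selected_measurable : ∀ n k, MeasurableSet {ω | selected n ω = k}
  subModels_nonempty : ∀ n k, 1 < modelRank (design n) (model n k) →
    (subModels (design n) (model n) k).Nonempty

namespace Setting

variable {Ω : Type*} [MeasurableSpace Ω] {P : Measure Ω} {𝒳 : Type*} {Γ : ℕ → Type*}
  (S : Setting P 𝒳 Γ)

/-- The vector `fₙ` of values of the true regression function. -/
def fvec (n : ℕ) : EuclideanSpace ℝ (Fin n) := evalAt (S.design n) (S.truth n)

/-- The response vector `Yₙ`. -/
def Y (n : ℕ) (ω : Ω) : EuclideanSpace ℝ (Fin n) :=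
  S.fvec n + WithLp.toLp 2 (fun i => S.noise n i ω)

/-- The orthogonal projection `M_k` onto the column space of model `k`. -/
def proj (n : ℕ) (k : Γ n) : EuclideanSpace ℝ (Fin n) →L[ℝ] EuclideanSpace ℝ (Fin n) :=
  (colSpace (S.design n) (S.model n k)).starProjection

/-- The rank `r_k`. -/
def rk (n : ℕ) (k : Γ n) : ℕ := modelRank (S.design n) (S.model n k)

/-- `S₁(k)`. -/
def S₁ (n : ℕ) (k : Γ n) : Set (Γ n) := subModels (S.design n) (S.model n) k

/-- The residual sum of squares `‖Yₙ - M_k Yₙ‖²`. -/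
def rss (n : ℕ) (k : Γ n) (ω : Ω) : ℝ := ‖S.Y n ω - S.proj n k (S.Y n ω)‖ ^ 2

/-- The squared bias `‖(Iₙ - M_k) fₙ‖²`. -/
def bias (n : ℕ) (k : Γ n) : ℝ := ‖S.fvec n - S.proj n k (S.fvec n)‖ ^ 2

/-- The information criterion of model `k`, with `s2` in the role of the error variance. -/
def IC (s2 : ℝ) (n : ℕ) (k : Γ n) (ω : Ω) : ℝ :=
  S.rss n k ω + S.lam n * Real.log n * S.rk n k * s2 - n * s2
    + S.d * Real.sqrt n * Real.log n * s2

open Classical in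
/-- The parametricness index, with `s2` in the role of the error variance. -/
def PIwith (s2 : ℝ) (n : ℕ) (ω : Ω) : ℝ :=
  if 1 < S.rk n (S.selected n ω) then
    ⨅ k : S.S₁ n (S.selected n ω), S.IC s2 n k ω / S.IC s2 n (S.selected n ω) ω
  else n

/-- The parametricness index `PIₙ` when `σ` is known. -/
def PI (n : ℕ) (ω : Ω) : ℝ := S.PIwith (S.sigma ^ 2) n ω

/-- The variance estimator based on the selected model. -/
def sigmaHatSq (n : ℕ) (ω : Ω) : ℝ :=
  S.rss n (S.selected n ω) ω / ((n : ℝ) - S.rk n (S.selected n ω))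

/-- The parametricness index `PIₙ` when `σ` is estimated from the selected model. -/
def PIhat (n : ℕ) (ω : Ω) : ℝ := S.PIwith (S.sigmaHatSq n ω) n ω

/-! ### Parametric scenario -/

/-- The true model at sample size `n` is the candidate `k*ₙ`, of rank larger than one
(a rank larger than one is possible only for `n ≥ 2`). -/
def Parametric (kstar : (n : ℕ) → Γ n) : Prop :=
  ∀ᶠ n in atTop, S.truth n ∈ S.model n (kstar n) ∧ 1 < S.rk n (kstar n)

/-- Consistency of the selection method when the true model is `k*ₙ`. -/
def SelectionConsistent (kstar : (n : ℕ) → Γ n) : Prop :=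
  Tendsto (fun n => P {ω | S.selected n ω = kstar n}) atTop (𝓝 1)

/-- `Aₙ = inf_{k ∈ S₁(k*ₙ)} ‖(Iₙ - M_k) fₙ‖² / σ²`. -/
def A (kstar : (n : ℕ) → Γ n) (n : ℕ) : ℝ :=
  ⨅ k : S.S₁ n (kstar n), S.bias n k / S.sigma ^ 2

/-- `Aₙ` is of order `n ^ (1/2 + τ)` or higher. -/
def CondP1 (kstar : (n : ℕ) → Γ n) (τ : ℝ) : Prop :=
  ∃ c : ℝ, 0 < c ∧ ∀ᶠ n : ℕ in atTop, c * (n : ℝ) ^ (1 / 2 + τ) ≤ S.A kstar n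

/-- `r_{k*ₙ} λₙ log n = o(n ^ (1/2 + τ))`. -/
def CondP2 (kstar : (n : ℕ) → Γ n) (τ : ℝ) : Prop :=
  (fun n : ℕ => (S.rk n (kstar n) : ℝ) * S.lam n * Real.log n)
    =o[atTop] (fun n : ℕ => (n : ℝ) ^ (1 / 2 + τ))

/-! ### Nonparametric scenario -/

/-- The true regression function belongs to none of the candidate models. -/
def Nonparametric : Prop :=
  ∀ᶠ n in atTop, ∀ k : Γ n, S.truth n ∉ S.model n k

/-- `(λₙ log n - 1) r_k + ‖(Iₙ - M_k) fₙ‖² / σ² + d n^{1/2} log n`. -/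
def D (n : ℕ) (k : Γ n) : ℝ :=
  (S.lam n * Real.log n - 1) * S.rk n k + S.bias n k / S.sigma ^ 2
    + S.d * Real.sqrt n * Real.log n

/-- `B_{j,n}`, the infimum of the above over the models of rank `j`. -/
def B (j n : ℕ) : ℝ := ⨅ k : {k : Γ n // S.rk n k = j}, S.D n k

/-- `N_j`, the number of candidate models of rank `j`. -/
def N (n j : ℕ) : ℕ∞ := Set.encard {k : Γ n | S.rk n k = j}

/-- `L_j`, the maximal cardinality of `S₁(k)` over the models of rank `j`. -/
def L (n j : ℕ) : ℕ∞ := ⨆ k : {k : Γ n // S.rk n k = j}, Set.encard (S.S₁ n k)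

def CondN1 (a b : ℕ → ℕ) : Prop :=
  Tendsto (fun n => P {ω | a n ≤ S.rk n (S.selected n ω) ∧ S.rk n (S.selected n ω) ≤ b n})
      atTop (𝓝 1) ∧
    Tendsto (fun n => ⨆ j : Set.Icc (a n) (b n), S.B j n / ((n : ℝ) - (j : ℕ))) atTop (𝓝 0)

def CondN2 (a b : ℕ → ℕ) : Prop :=
  (∃ (ζ : ℕ → ℝ) (c₀ : ℝ), (∀ n, 0 < ζ n) ∧ Tendsto ζ atTop (𝓝 0) ∧ 0 < c₀ ∧
    ∀ᶠ n in atTop, ∀ j ∈ Set.Icc (a n) (b n),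
      ((S.N n j * S.L n j : ℕ∞) : ℝ≥0∞) ≤ ENNReal.ofReal (c₀ * Real.exp (ζ n * S.B j n)) ∧
      (S.N n j : ℝ≥0∞) ≤
        ENNReal.ofReal (c₀ * Real.exp (S.B j n ^ 2 / (10 * ((n : ℝ) - j))))) ∧
  Tendsto (fun n => ∑ j ∈ Finset.Icc (a n) (b n),
    Real.exp (-(S.B j n ^ 2 / (10 * ((n : ℝ) - j))))) atTop (𝓝 0)

def CondN3 (a b : ℕ → ℕ) : Prop :=
  Tendsto (fun n => ⨆ k : {k : Γ n // a n ≤ S.rk n k ∧ S.rk n k ≤ b n},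
    (⨅ k' : S.S₁ n k, ‖S.proj n k (S.fvec n) - S.proj n k' (S.fvec n)‖ ^ 2) / S.D n k)
    atTop (𝓝 0)

end Setting

/-- Convergence in probability to `+∞`. -/
def TendstoInProbAtTop {Ω : Type*} [MeasurableSpace Ω] (P : Measure Ω) (X : ℕ → Ω → ℝ) : Prop :=
  ∀ M : ℝ, Tendsto (fun n => P {ω | M < X n ω}) atTop (𝓝 1)

end ParamIndex

end

/-! For `k'` in `S₁(k)`, nestedness of the column spaces gives `IC(k') = IC(k) + ‖(M_k - M_k')Y‖² -
λ log n · s²`. So the index minus one is the infimum of a gap over `IC(k)`, and everything rests on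
comparing the sizes of these two quantities. In terms of the standardised noise `g`, `IC(k; σ²)/σ²`
equals `D_k` plus a centred chi-square with `n - r_k` degrees of freedom plus a Gaussian linear term
(`IC_sigma_eq`).

Parametric case. The true model has no bias, so its criterion is a penalty of order `o(n^(1/2+τ))`
plus a chi-square fluctuation that is barely larger than `√n` (`abs_IC_le_eventually`). Dropping one
dimension costs a bias of order at least `n^(1/2+τ)`, which the fitted noise cannot hide
(`parametric_gap`). Hence the ratio explodes in absolute value. Its sign is that of `IC(k*)`, which
is positive once the penalty dominates `√n`. With the estimated variance the residual term cancels
exactly, so the criterion is `σ̂²` times the penalty.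

Nonparametric case. Chernoff bounds and a union over all candidates of rank in `[a_n, b_n]` show
that, uniformly, `IC(k)` is at least a fixed fraction of `σ² D_k`, while the gap of one well-chosen
submodel is at most a small multiple of it (`measure_iUnion_badEvent_le`). The lower bound on the
index needs no probability for the gap, since a squared norm is nonnegative and `λ log n` is small
against `D_k` (`abs_PI_sub_one_le`). -/

noncomputable section

namespace ParamIndex

/-! ### Gaussian vectors: chi-square law of projections and exponential tail bounds. -/

section Gaussian

variable {E : Type*} [NormedAddCommGroup E] [InnerProductSpace ℝ E] [FiniteDimensional ℝ E]
  [MeasurableSpace E] [BorelSpace E]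

/-- Characteristic functions agree because `⟪Px, t⟫ = ⟪x, t⟫` for `t ∈ W`. This reduces every
squared projection of the noise to a chi-square with `finrank W` degrees of freedom. -/
theorem map_orthogonalProjectionOnto_stdGaussian (W : Submodule ℝ E) :
    (stdGaussian E).map W.orthogonalProjectionOnto = stdGaussian W := by
  apply Measure.ext_of_charFun
  ext t
  rw [charFun_stdGaussian, charFun_apply,
    integral_map (by fun_prop) (Measurable.aestronglyMeasurable (by fun_prop))]
  have h := charFun_stdGaussian (E := E) (t : E)
  rw [charFun_apply] at h
  rw [show ‖t‖ = ‖(t : E)‖ from rfl, ← h]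
  congr 1
  ext x
  congr 3
  have h1 := Submodule.inner_starProjection_left_eq_right W x t
  rwa [Submodule.starProjection_eq_self_iff.2 t.2] at h1

theorem integral_exp_mul_sq_gaussianReal {s : ℝ} (hs : s < 1 / 2) :
    ∫ x, Real.exp (s * x ^ 2) ∂(gaussianReal 0 1) = (√(1 - 2 * s))⁻¹ := by
  rw [integral_gaussianReal_eq_integral_smul (by simp)]
  have h : ∀ x : ℝ, gaussianPDFReal 0 1 x • Real.exp (s * x ^ 2)
      = (√(2 * Real.pi))⁻¹ * Real.exp (-(1 / 2 - s) * x ^ 2) := by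
    intro x
    rw [gaussianPDFReal, smul_eq_mul, mul_assoc, ← Real.exp_add]
    simp only [NNReal.coe_one, mul_one, sub_zero]
    congr 2
    ring
  simp_rw [h]
  rw [integral_const_mul, integral_gaussian, ← Real.sqrt_inv, ← Real.sqrt_inv,
    ← Real.sqrt_mul (by positivity)]
  congr 1
  have := Real.pi_pos
  have : (1 / 2 - s) ≠ 0 := by linarith
  have : (1 - 2 * s) ≠ 0 := by linarith
  field_simp

theorem integral_exp_mul_norm_sq_stdGaussian {s : ℝ} (hs : s < 1 / 2) :
    ∫ x, Real.exp (s * ‖x‖ ^ 2) ∂(stdGaussian E) = ((√(1 - 2 * s))⁻¹) ^ Module.finrank ℝ E := by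
  rw [stdGaussian_eq_map_pi_orthonormalBasis (stdOrthonormalBasis ℝ E),
    integral_map (Measurable.aemeasurable (by fun_prop))
      (Measurable.aestronglyMeasurable (by fun_prop))]
  have h : ∀ x : Fin (Module.finrank ℝ E) → ℝ,
      Real.exp (s * ‖∑ i, x i • stdOrthonormalBasis ℝ E i‖ ^ 2)
        = ∏ i, Real.exp (s * x i ^ 2) := by
    intro x
    rw [← Real.exp_sum, ← Finset.mul_sum]
    congr 2
    rw [← (stdOrthonormalBasis ℝ E).sum_sq_inner_right]
    congr 1
    ext i
    rw [(stdOrthonormalBasis ℝ E).orthonormal.inner_right_fintype]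
  simp_rw [h]
  rw [integral_fintype_prod_eq_prod (f := fun _ x => Real.exp (s * x ^ 2))]
  simp [integral_exp_mul_sq_gaussianReal hs]

/-- By Fubini: with all coordinates but one fixed, the remaining one is confined to two points, and
a nondegenerate real Gaussian has no atoms. -/
theorem stdGaussian_norm_sq_eq_null (h : 0 < Module.finrank ℝ E) (c : ℝ) :
    stdGaussian E {x | ‖x‖ ^ 2 = c} = 0 := by
  obtain ⟨m, hm⟩ : ∃ m, Module.finrank ℝ E = m + 1 := ⟨_, (Nat.succ_pred_eq_of_pos h).symm⟩
  let b := (stdOrthonormalBasis ℝ E).reindex (finCongr hm)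
  have hmeas : MeasurableSet {x : E | ‖x‖ ^ 2 = c} :=
    measurableSet_eq_fun (by fun_prop) (by fun_prop)
  rw [stdGaussian_eq_map_pi_orthonormalBasis b, Measure.map_apply (by fun_prop) hmeas]
  have h1 : ((fun x : Fin (m + 1) → ℝ => ∑ i, x i • b i) ⁻¹' {x | ‖x‖ ^ 2 = c})
      = {x | ∑ i, x i ^ 2 = c} := by
    ext x
    simp only [Set.mem_preimage, Set.mem_ofPred_eq]
    rw [← b.sum_sq_inner_right]
    simp_rw [b.orthonormal.inner_right_fintype]
  rw [h1]
  have hm1 : MeasurableSet {x : Fin (m + 1) → ℝ | ∑ i, x i ^ 2 = c} :=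
    measurableSet_eq_fun (by fun_prop) (by fun_prop)
  have mp := (measurePreserving_piFinSuccAbove
    (fun _ : Fin (m + 1) => gaussianReal 0 1) 0).symm
  rw [← mp.measure_preimage hm1.nullMeasurableSet, Measure.prod_apply_symm
    (mp.measurable hm1), lintegral_eq_zero_of_ae_eq_zero]
  refine ae_of_all _ fun y => ?_
  have : NullSingletonClass (gaussianReal 0 1) := nullSingletonClass_gaussianReal (by simp)
  refine measure_mono_null (t := {√(c - ∑ i, y i ^ 2), -√(c - ∑ i, y i ^ 2)}) ?_
    (Set.Finite.measure_zero (by simp) _)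
  intro t ht
  simp [MeasurableEquiv.piFinSuccAbove, Fin.sum_univ_succ] at ht
  have : t ^ 2 = c - ∑ i, y i ^ 2 := by linarith
  rw [← this, Real.sqrt_sq_eq_abs]
  rcases abs_choice t with h | h <;> simp [h]

variable {Ω : Type*} [MeasurableSpace Ω] {P : Measure Ω} {X : Ω → E}

theorem starProjection_norm_sq_eq_null (hX : HasLaw X (stdGaussian E) P)
    (W : Submodule ℝ E) (hW : 0 < Module.finrank ℝ W) (c : ℝ) :
    P {ω | ‖W.starProjection (X ω)‖ ^ 2 = c} = 0 := by
  rw [hX.measure_eq (p := fun x => ‖W.starProjection x‖ ^ 2 = c)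
    (measurableSet_eq_fun (by fun_prop) (by fun_prop)), ← stdGaussian_norm_sq_eq_null hW c,
    ← map_orthogonalProjectionOnto_stdGaussian, Measure.map_apply (by fun_prop)
    (measurableSet_eq_fun (by fun_prop) (by fun_prop))]
  rfl

theorem mgf_starProjection_norm_sq (hX : HasLaw X (stdGaussian E) P)
    (W : Submodule ℝ E) {s : ℝ} (hs : s < 1 / 2) :
    mgf (fun ω => ‖W.starProjection (X ω)‖ ^ 2) P s
      = ((√(1 - 2 * s))⁻¹) ^ Module.finrank ℝ W := by
  rw [← integral_exp_mul_norm_sq_stdGaussian hs, ← map_orthogonalProjectionOnto_stdGaussian,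
    integral_map (by fun_prop) (Measurable.aestronglyMeasurable (by fun_prop)), mgf]
  exact hX.integral_comp (f := fun x => Real.exp (s * ‖W.starProjection x‖ ^ 2))
    (Measurable.aestronglyMeasurable (by fun_prop))

theorem integrable_exp_starProjection_norm_sq (hX : HasLaw X (stdGaussian E) P)
    (W : Submodule ℝ E) {s : ℝ} (hs : s < 1 / 2) :
    Integrable (fun ω => Real.exp (s * ‖W.starProjection (X ω)‖ ^ 2)) P := by
  -- The integral of a non-integrable function is zero by convention, whereas the value just
  -- computed is positive.
  by_contra h
  have h0 := mgf_starProjection_norm_sq hX W hs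
  rw [mgf, integral_undef h] at h0
  have : 0 < √(1 - 2 * s) := Real.sqrt_pos.2 (by linarith)
  exact absurd h0 (by positivity)

theorem inv_sqrt_pow_le_exp {u v : ℝ} (hu : 0 < u) (h : -v ≤ Real.log u) (m : ℕ) :
    ((√u)⁻¹) ^ m ≤ Real.exp (m * v / 2) := by
  have h1 : (√u)⁻¹ ≤ Real.exp (v / 2) := by
    rw [← Real.sqrt_inv, Real.sqrt_le_iff]
    refine ⟨by positivity, ?_⟩
    rw [← Real.exp_nat_mul, ← Real.exp_log hu, ← Real.exp_neg]
    apply Real.exp_le_exp.2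
    push_cast
    linarith
  calc _ ≤ Real.exp (v / 2) ^ m := by gcongr
    _ = _ := by rw [← Real.exp_nat_mul]; congr 1; ring

theorem chiSq_lower_tail [IsProbabilityMeasure P] (hX : HasLaw X (stdGaussian E) P)
    (W : Submodule ℝ E) {y t : ℝ} (ht0 : 0 ≤ t) :
    P.real {ω | ‖W.starProjection (X ω)‖ ^ 2 ≤ Module.finrank ℝ W - y}
      ≤ Real.exp (-t * y + Module.finrank ℝ W * t ^ 2) := by
  set m := Module.finrank ℝ W with hm
  refine (measure_le_le_exp_mul_mgf (t := -t) _ (by linarith)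
    (integrable_exp_starProjection_norm_sq hX W (by linarith))).trans ?_
  rw [mgf_starProjection_norm_sq hX W (by linarith), ← hm]
  have hlog : -(-(2 * t) + 2 * t ^ 2) ≤ Real.log (1 - 2 * -t) := by
    have := Real.le_log_one_add_of_nonneg (x := 2 * t) (by linarith)
    rw [show 1 - 2 * -t = 1 + 2 * t by ring]
    refine le_trans ?_ this
    rw [le_div_iff₀ (by linarith)]
    nlinarith [mul_nonneg ht0 (mul_nonneg ht0 ht0)]
  refine (mul_le_mul_of_nonneg_left (inv_sqrt_pow_le_exp (by linarith) hlog m)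
    (Real.exp_pos _).le).trans ?_
  rw [← Real.exp_add]
  apply Real.exp_le_exp.2
  apply le_of_eq
  ring

theorem chiSq_upper_tail [IsProbabilityMeasure P] (hX : HasLaw X (stdGaussian E) P)
    (W : Submodule ℝ E) {y t : ℝ} (ht0 : 0 ≤ t) (ht : t ≤ 1 / 4) :
    P.real {ω | Module.finrank ℝ W + y ≤ ‖W.starProjection (X ω)‖ ^ 2}
      ≤ Real.exp (-t * y + 4 * Module.finrank ℝ W * t ^ 2) := by
  set m := Module.finrank ℝ W with hm
  refine (measure_ge_le_exp_mul_mgf (t := t) _ ht0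
    (integrable_exp_starProjection_norm_sq hX W (by linarith))).trans ?_
  rw [mgf_starProjection_norm_sq hX W (by linarith), ← hm]
  -- From `-log u ≤ u⁻¹ - 1`; the bound `(1 - 2t)⁻¹ ≤ 1 + 2t + 8t²` is where `t ≤ 1/4` enters.
  have hlog : -(2 * t + 8 * t ^ 2) ≤ Real.log (1 - 2 * t) := by
    have := Real.one_sub_inv_le_log_of_pos (x := 1 - 2 * t) (by linarith)
    refine le_trans ?_ this
    have h2 : (1 - 2 * t)⁻¹ ≤ 1 + 2 * t + 8 * t ^ 2 := by
      rw [inv_le_iff_one_le_mul₀ (by linarith)]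
      nlinarith [mul_nonneg ht0 ht0, mul_nonneg (mul_nonneg ht0 ht0) (sub_nonneg.2 ht)]
    linarith
  refine (mul_le_mul_of_nonneg_left (inv_sqrt_pow_le_exp (by linarith) hlog m)
    (Real.exp_pos _).le).trans ?_
  rw [← Real.exp_add]
  apply Real.exp_le_exp.2
  apply le_of_eq
  ring

/-- Chernoff with the exponent `y / V`. Using an upper bound `V > 0` in place of the variance `‖v‖²`
keeps the case `v = 0` inside the statement. -/
theorem inner_tail [IsProbabilityMeasure P] (hX : HasLaw X (stdGaussian E) P) (v : E) {y V : ℝ} (hy : 0 ≤ y)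
    (hV : 0 < V) (hvV : ‖v‖ ^ 2 ≤ V) :
    P.real {ω | y ≤ inner ℝ v (X ω)} ≤ Real.exp (-(y ^ 2 / (2 * V))) := by
  have hlaw : P.map (fun ω => inner ℝ v (X ω)) = gaussianReal 0 (‖v‖₊ ^ 2) := by
    have h1 := (hX.hasGaussianLaw.map (innerSL ℝ v)).map_eq_gaussianReal
    have h2 : P[(innerSL ℝ v) ∘ X] = 0 := by
      rw [hX.integral_comp (Measurable.aestronglyMeasurable (by fun_prop))]
      exact integral_strongDual_stdGaussian (innerSL ℝ v)
    have h3 : Var[(innerSL ℝ v) ∘ X; P] = ‖v‖ ^ 2 := by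
      have := variance_dual_stdGaussian (innerSL ℝ v)
      rw [innerSL_apply_norm] at this
      rw [← this, ← hX.map_eq, variance_map (Measurable.aemeasurable (by fun_prop)) hX.aemeasurable]
    rw [h2, h3] at h1
    have h4 : ‖v‖₊ ^ 2 = (‖v‖ ^ 2).toNNReal := by
      ext
      rw [Real.coe_toNNReal _ (by positivity)]
      simp
    rw [h4]
    exact h1
  set t := y / V with ht
  have ht0 : 0 ≤ t := by positivity
  have hint : Integrable (fun ω => Real.exp (t * inner ℝ v (X ω))) P := by
    by_contra h
    have h0 := mgf_gaussianReal hlaw t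
    rw [mgf, integral_undef h] at h0
    exact absurd h0 (Real.exp_pos _).ne
  refine (measure_ge_le_exp_mul_mgf (t := t) _ ht0 hint).trans ?_
  rw [mgf_gaussianReal hlaw, ← Real.exp_add]
  apply Real.exp_le_exp.2
  have : ((‖v‖₊ ^ 2 : NNReal) : ℝ) * t ^ 2 ≤ V * t ^ 2 := by
    push_cast
    gcongr
  have h2 : V * t ^ 2 = y ^ 2 / V := by rw [ht]; field_simp
  have h3 : t * y = y ^ 2 / V := by rw [ht]; field_simp
  have h4 : y ^ 2 / (2 * V) = y ^ 2 / V / 2 := by field_simp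
  rw [h4]
  linarith

end Gaussian

/-! ### Projections onto nested subspaces. -/

section Projection

variable {E : Type*} [NormedAddCommGroup E] [InnerProductSpace ℝ E] [FiniteDimensional ℝ E]
  {U W : Submodule ℝ E}

theorem starProjection_sub_of_le (h : U ≤ W) (y : E) :
    W.starProjection y - U.starProjection y = (Uᗮ ⊓ W).starProjection y := by
  refine (Submodule.eq_starProjection_of_mem_of_inner_eq_zero ?_ ?_).symm
  · refine ⟨?_, W.sub_mem (Submodule.starProjection_apply_mem _ _)
      (h (Submodule.starProjection_apply_mem _ _))⟩
    have h1 := Submodule.sub_starProjection_mem_orthogonal (K := U) y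
    have h2 := Submodule.orthogonal_le h (Submodule.sub_starProjection_mem_orthogonal (K := W) y)
    simpa using Uᗮ.sub_mem h1 h2
  · rintro w ⟨hw1, hw2⟩
    have h1 : inner ℝ (y - W.starProjection y) w = 0 :=
      Submodule.inner_left_of_mem_orthogonal hw2
        (Submodule.sub_starProjection_mem_orthogonal y)
    have h2 : inner ℝ (U.starProjection y) w = 0 :=
      Submodule.inner_right_of_mem_orthogonal (Submodule.starProjection_apply_mem _ _) hw1
    rw [show y - (W.starProjection y - U.starProjection y)
      = (y - W.starProjection y) + U.starProjection y by abel, inner_add_left, h1, h2, add_zero]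

theorem norm_sub_starProjection_sq_of_le (h : U ≤ W) (y : E) :
    ‖y - U.starProjection y‖ ^ 2
      = ‖y - W.starProjection y‖ ^ 2 + ‖W.starProjection y - U.starProjection y‖ ^ 2 := by
  have h1 : inner ℝ (y - W.starProjection y) (W.starProjection y - U.starProjection y) = 0 :=
    Submodule.inner_left_of_mem_orthogonal (W.sub_mem (Submodule.starProjection_apply_mem _ _)
      (h (Submodule.starProjection_apply_mem _ _))) (Submodule.sub_starProjection_mem_orthogonal y)
  have := norm_add_sq_real (y - W.starProjection y) (W.starProjection y - U.starProjection y)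
  rw [h1] at this
  rw [show y - U.starProjection y
    = (y - W.starProjection y) + (W.starProjection y - U.starProjection y) by abel]
  linarith

theorem norm_starProjection_sub_le (h : U ≤ W) (y : E) :
    ‖W.starProjection y - U.starProjection y‖ ≤ ‖W.starProjection y‖ := by
  have h1 := starProjection_sub_of_le h (W.starProjection y)
  have h2 : W.starProjection (W.starProjection y) = W.starProjection y :=
    Submodule.starProjection_eq_self_iff.2 (Submodule.starProjection_apply_mem _ _)
  have h3 : U.starProjection (W.starProjection y) = U.starProjection y := by
    have := congrArg (fun T => T y) (Submodule.starProjection_comp_starProjection_of_le h)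
    simpa using this
  rw [h2, h3] at h1
  rw [h1]
  exact Submodule.norm_starProjection_apply_le _ _

theorem sub_starProjection_eq (W : Submodule ℝ E) (y : E) :
    y - W.starProjection y = Wᗮ.starProjection y := by
  simp

theorem finrank_orthogonal_inf (h : U ≤ W) :
    Module.finrank ℝ (Uᗮ ⊓ W : Submodule ℝ E) = Module.finrank ℝ W - Module.finrank ℝ U := by
  have := Submodule.finrank_add_inf_finrank_orthogonal h
  omega

end Projection

/-! ### Convergence of probabilities through bad events. -/

section Convergence

variable {Ω : Type*} [MeasurableSpace Ω] {P : Measure Ω}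

/-- Only subadditivity is used, so the good sets need not be measurable; no measurability of the
index is ever required. -/
theorem tendsto_measure_one_of_bad [IsProbabilityMeasure P] {bad good : ℕ → Set Ω}
    (hbad : Tendsto (fun n => P (bad n)) atTop (𝓝 0))
    (h : ∀ᶠ n in atTop, ∀ ω, ω ∉ bad n → ω ∈ good n) :
    Tendsto (fun n => P (good n)) atTop (𝓝 1) := by
  have h1 : Tendsto (fun n => 1 - P (bad n)) atTop (𝓝 1) := by
    simpa using ENNReal.Tendsto.sub (tendsto_const_nhds (x := (1 : ℝ≥0∞))) hbad (by simp)
  refine tendsto_of_tendsto_of_tendsto_of_le_of_le' h1 tendsto_const_nhds ?_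
    (Eventually.of_forall fun n => prob_le_one)
  filter_upwards [h] with n hn
  rw [tsub_le_iff_right, ← measure_univ (μ := P)]
  refine (measure_mono fun ω _ => ?_).trans (measure_union_le (good n) (bad n))
  by_cases hω : ω ∈ bad n
  · exact Or.inr hω
  · exact Or.inl (hn ω hω)

theorem tendsto_measure_compl [IsProbabilityMeasure P] {s : ℕ → Set Ω} (hs : ∀ n, MeasurableSet (s n))
    (h : Tendsto (fun n => P (s n)) atTop (𝓝 1)) :
    Tendsto (fun n => P (s n)ᶜ) atTop (𝓝 0) := by
  simp_rw [fun n => prob_compl_eq_one_sub (μ := P) (hs n)]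
  simpa using ENNReal.Tendsto.sub (tendsto_const_nhds (x := (1 : ℝ≥0∞))) h (by simp)

theorem tendsto_measure_zero_of_real_le [IsProbabilityMeasure P] {s : ℕ → Set Ω} {u : ℕ → ℝ}
    (h : ∀ᶠ n in atTop, P.real (s n) ≤ u n) (hu : Tendsto u atTop (𝓝 0)) :
    Tendsto (fun n => P (s n)) atTop (𝓝 0) := by
  have h1 : Tendsto (fun n => P.real (s n)) atTop (𝓝 0) :=
    tendsto_of_tendsto_of_tendsto_of_le_of_le' tendsto_const_nhds hu
      (Eventually.of_forall fun n => measureReal_nonneg) h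
  have h2 := ENNReal.tendsto_ofReal h1
  simpa using h2

theorem tendsto_measure_union {s t : ℕ → Set Ω}
    (hs : Tendsto (fun n => P (s n)) atTop (𝓝 0)) (ht : Tendsto (fun n => P (t n)) atTop (𝓝 0)) :
    Tendsto (fun n => P (s n ∪ t n)) atTop (𝓝 0) :=
  tendsto_of_tendsto_of_tendsto_of_le_of_le tendsto_const_nhds (by simpa using hs.add ht)
    (fun _ => zero_le) (fun _ => measure_union_le _ _)

end Convergence

/-! ### Algebra of the information criterion and of the index. -/

namespace Setting

variable {Ω : Type*} [MeasurableSpace Ω] {P : Measure Ω} {𝒳 : Type*} {Γ : ℕ → Type*}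
  (S : Setting P 𝒳 Γ)

/-- The column space of model `k` in `ℝⁿ`. -/
def col (n : ℕ) (k : Γ n) : Submodule ℝ (EuclideanSpace ℝ (Fin n)) :=
  colSpace (S.design n) (S.model n k)

/-- The error vector in units of its standard deviation. -/
def stdNoise (n : ℕ) (ω : Ω) : EuclideanSpace ℝ (Fin n) :=
  WithLp.toLp 2 (fun i => S.noise n i ω / S.sigma)

theorem proj_eq (n : ℕ) (k : Γ n) : S.proj n k = (S.col n k).starProjection := rfl

theorem rk_eq (n : ℕ) (k : Γ n) : S.rk n k = Module.finrank ℝ (S.col n k) := rfl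

theorem Y_eq (n : ℕ) (ω : Ω) : S.Y n ω = S.fvec n + S.sigma • S.stdNoise n ω := by
  have := S.sigma_pos.ne'
  ext i
  simp only [Y, stdNoise, PiLp.add_apply, PiLp.smul_apply, smul_eq_mul]
  field_simp

theorem stdNoise_hasLaw (n : ℕ) :
    HasLaw (S.stdNoise n) (stdGaussian (EuclideanSpace ℝ (Fin n))) P := by
  have hσ := S.sigma_pos
  have h1 : ∀ i, HasLaw (fun ω => S.noise n i ω / S.sigma) (gaussianReal 0 1) P := by
    intro i
    have := gaussianReal_div_const (S.noise_law n i) S.sigma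
    convert this using 2
    · simp
    · ext
      simp only [NNReal.coe_one, NNReal.coe_div, Real.coe_toNNReal _ (sq_nonneg S.sigma)]
      exact (div_self (by positivity)).symm
  have h2 : iIndepFun (fun i ω => S.noise n i ω / S.sigma) P :=
    (S.noise_indep n).comp (fun _ x => x / S.sigma) (fun _ => by fun_prop)
  have h3 := iIndepFun.hasLaw_pi h1 h2
  have h4 : HasLaw (WithLp.toLp 2 : (Fin n → ℝ) → EuclideanSpace ℝ (Fin n))
    (stdGaussian (EuclideanSpace ℝ (Fin n))) (Measure.pi fun _ => gaussianReal 0 1) :=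
    ⟨by fun_prop, map_pi_eq_stdGaussian⟩
  exact h4.comp h3

theorem finrank_col_orthogonal (n : ℕ) (k : Γ n) :
    (Module.finrank ℝ (S.col n k)ᗮ : ℝ) = n - S.rk n k := by
  have := Submodule.finrank_add_finrank_orthogonal (S.col n k)
  rw [finrank_euclideanSpace_fin] at this
  have h : (Module.finrank ℝ (S.col n k) : ℝ) + Module.finrank ℝ (S.col n k)ᗮ = n := by
    exact_mod_cast this
  rw [rk_eq]
  linarith

theorem col_le {n : ℕ} {k k' : Γ n} (h : k' ∈ S.S₁ n k) : S.col n k' ≤ S.col n k :=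
  Submodule.map_mono h.1

theorem finrank_orthogonal_inf_col {n : ℕ} {k k' : Γ n} (h : k' ∈ S.S₁ n k) :
    Module.finrank ℝ ((S.col n k')ᗮ ⊓ S.col n k : Submodule ℝ _) = 1 := by
  rw [finrank_orthogonal_inf (S.col_le h)]
  have : S.rk n k' + 1 = S.rk n k := h.2
  rw [rk_eq, rk_eq] at this
  omega

theorem rss_submodel {n : ℕ} {k k' : Γ n} (h : k' ∈ S.S₁ n k) (ω : Ω) :
    S.rss n k' ω = S.rss n k ω + ‖S.proj n k (S.Y n ω) - S.proj n k' (S.Y n ω)‖ ^ 2 :=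
  norm_sub_starProjection_sq_of_le (S.col_le h) _

/-- Pythagoras for the residuals, together with the rank dropping by exactly one, leaves a single
squared norm and a single penalty unit. -/
theorem IC_submodel {n : ℕ} {k k' : Γ n} (h : k' ∈ S.S₁ n k) (s2 : ℝ) (ω : Ω) :
    S.IC s2 n k' ω = S.IC s2 n k ω + (‖S.proj n k (S.Y n ω) - S.proj n k' (S.Y n ω)‖ ^ 2
      - S.lam n * Real.log n * s2) := by
  have h1 : (S.rk n k' : ℝ) + 1 = S.rk n k := by exact_mod_cast h.2
  rw [IC, IC, S.rss_submodel h, ← h1]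
  ring

theorem one_le_lam_mul_log {n : ℕ} (hn : 2 ≤ n) : 1 ≤ S.lam n * Real.log n := by
  have h1 : 0 < Real.log n := Real.log_pos (by exact_mod_cast hn)
  have := mul_le_mul_of_nonneg_right (S.lam_ge n hn) h1.le
  rwa [inv_mul_cancel₀ h1.ne'] at this

theorem IC_sigma_eq (n : ℕ) (k : Γ n) (ω : Ω) :
    S.IC (S.sigma ^ 2) n k ω = S.sigma ^ 2 * (S.D n k
      + (‖(S.col n k)ᗮ.starProjection (S.stdNoise n ω)‖ ^ 2 - (n - S.rk n k))
      + 2 * inner ℝ (S.sigma⁻¹ • (S.fvec n - S.proj n k (S.fvec n))) (S.stdNoise n ω)) := by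
  have hσ := S.sigma_pos
  have h1 : S.rss n k ω = S.bias n k
      + 2 * S.sigma * inner ℝ (S.fvec n - S.proj n k (S.fvec n)) (S.stdNoise n ω)
      + S.sigma ^ 2 * ‖(S.col n k)ᗮ.starProjection (S.stdNoise n ω)‖ ^ 2 := by
    rw [rss, bias, Y_eq, proj_eq, sub_starProjection_eq, sub_starProjection_eq, map_add, map_smul,
      norm_add_sq_real, real_inner_smul_right, norm_smul, mul_pow, Real.norm_eq_abs, sq_abs]
    have h2 := Submodule.inner_starProjection_left_eq_right (S.col n k)ᗮ
      ((S.col n k)ᗮ.starProjection (S.fvec n)) (S.stdNoise n ω)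
    rw [Submodule.starProjection_eq_self_iff.2 (Submodule.starProjection_apply_mem _ _)] at h2
    rw [h2]
    ring
  rw [IC, h1, D, real_inner_smul_left]
  field_simp
  ring

/-- If every submodel raises the criterion by at least `K` times its positive value at the selected
model, then the index is at least `1 + K`. -/
theorem le_PIwith {s2 K : ℝ} {n : ℕ} {ω : Ω} (hr : 1 < S.rk n (S.selected n ω))
    (hpos : 0 < S.IC s2 n (S.selected n ω) ω)
    (h : ∀ k' ∈ S.S₁ n (S.selected n ω), K * S.IC s2 n (S.selected n ω) ω ≤
      ‖S.proj n (S.selected n ω) (S.Y n ω) - S.proj n k' (S.Y n ω)‖ ^ 2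
      - S.lam n * Real.log n * s2) :
    1 + K ≤ S.PIwith s2 n ω := by
  rw [PIwith, if_pos hr]
  have : Nonempty (S.S₁ n (S.selected n ω)) := (S.subModels_nonempty n _ hr).to_subtype
  refine le_ciInf fun k' => ?_
  rw [S.IC_submodel k'.2, le_div_iff₀ hpos]
  have := h k' k'.2
  linarith

theorem PIwith_le {s2 K : ℝ} {n : ℕ} {ω : Ω} (hr : 1 < S.rk n (S.selected n ω))
    (hpos : 0 < S.IC s2 n (S.selected n ω) ω) {k' : Γ n} (hk' : k' ∈ S.S₁ n (S.selected n ω))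
    (h : ‖S.proj n (S.selected n ω) (S.Y n ω) - S.proj n k' (S.Y n ω)‖ ^ 2
      - S.lam n * Real.log n * s2 ≤ K * S.IC s2 n (S.selected n ω) ω) :
    S.PIwith s2 n ω ≤ 1 + K := by
  rw [PIwith, if_pos hr]
  -- A real infimum is bounded by its terms only if the family is bounded below; here dropping the
  -- squared norm gives such a bound.
  refine (ciInf_le ⟨1 + -(S.lam n * Real.log n * s2) / S.IC s2 n (S.selected n ω) ω, ?_⟩
    ⟨k', hk'⟩).trans ?_
  · rintro _ ⟨k, rfl⟩
    simp only
    rw [S.IC_submodel k.2, add_div, div_self hpos.ne']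
    gcongr
    have := sq_nonneg
      ‖S.proj n (S.selected n ω) (S.Y n ω) - S.proj n k (S.Y n ω)‖
    linarith
  · rw [S.IC_submodel hk', div_le_iff₀ hpos]
    linarith

theorem PIwith_le_of_neg {s2 K : ℝ} {n : ℕ} {ω : Ω} (hr : 1 < S.rk n (S.selected n ω))
    (hneg : S.IC s2 n (S.selected n ω) ω < 0)
    (h : ∀ k' ∈ S.S₁ n (S.selected n ω), K * -S.IC s2 n (S.selected n ω) ω ≤
      ‖S.proj n (S.selected n ω) (S.Y n ω) - S.proj n k' (S.Y n ω)‖ ^ 2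
      - S.lam n * Real.log n * s2) :
    S.PIwith s2 n ω ≤ 1 - K := by
  rw [PIwith, if_pos hr]
  obtain ⟨k', hk'⟩ := S.subModels_nonempty n _ hr
  -- A negative denominator reverses the order, so boundedness below needs an upper bound on the
  -- gaps that is uniform over submodels: `‖M_k Y‖²` serves.
  refine (ciInf_le ⟨1 + (‖S.proj n (S.selected n ω) (S.Y n ω)‖ ^ 2
    - S.lam n * Real.log n * s2) / S.IC s2 n (S.selected n ω) ω, ?_⟩ ⟨k', hk'⟩).trans ?_
  · rintro _ ⟨k, rfl⟩
    simp only
    rw [S.IC_submodel k.2, add_div, div_self hneg.ne]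
    gcongr 1 + ?_
    refine div_le_div_of_nonpos_of_le hneg.le ?_
    gcongr
    exact norm_starProjection_sub_le (S.col_le k.2) _
  · rw [S.IC_submodel hk', div_le_iff_of_neg hneg]
    have := h k' hk'
    linarith

theorem proj_fvec_of_mem {n : ℕ} {k : Γ n} (h : S.truth n ∈ S.model n k) :
    S.proj n k (S.fvec n) = S.fvec n :=
  Submodule.starProjection_eq_self_iff.2 (Submodule.mem_map_of_mem h)

theorem rss_of_mem {n : ℕ} {k : Γ n} (h : S.truth n ∈ S.model n k) (ω : Ω) :
    S.rss n k ω = S.sigma ^ 2 * ‖(S.col n k)ᗮ.starProjection (S.stdNoise n ω)‖ ^ 2 := by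
  rw [rss, Y_eq, map_add, S.proj_fvec_of_mem h, map_smul, add_sub_add_left_eq_sub, ← smul_sub,
    norm_smul, mul_pow, Real.norm_eq_abs, sq_abs, proj_eq, sub_starProjection_eq]

theorem IC_sigma_of_mem {n : ℕ} {k : Γ n} (h : S.truth n ∈ S.model n k) (ω : Ω) :
    S.IC (S.sigma ^ 2) n k ω = S.sigma ^ 2 * (((S.lam n * Real.log n - 1) * S.rk n k
        + S.d * Real.sqrt n * Real.log n)
      + (‖(S.col n k)ᗮ.starProjection (S.stdNoise n ω)‖ ^ 2 - (n - S.rk n k))) := by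
  rw [IC_sigma_eq, D, bias, S.proj_fvec_of_mem h]
  simp

/-- Here `(M_k - M_k')Y = (I - M_k')f + σ(M_k - M_k')g`. The signal has norm at least `σ√α` and the
noise at most half of that, so half the signal survives. -/
theorem norm_proj_sub_ge {n : ℕ} {k k' : Γ n} (h : S.truth n ∈ S.model n k) (hk : k' ∈ S.S₁ n k)
    {α : ℝ} (hα : 0 ≤ α) (hbias : α ≤ S.bias n k' / S.sigma ^ 2) {ω : Ω}
    (hω : ‖(S.col n k).starProjection (S.stdNoise n ω)‖ ^ 2 ≤ α / 4) :
    S.sigma ^ 2 * (α / 4) ≤ ‖S.proj n k (S.Y n ω) - S.proj n k' (S.Y n ω)‖ ^ 2 := by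
  have hσ := S.sigma_pos
  set f := S.fvec n
  set g := S.stdNoise n ω
  set z := S.proj n k g - S.proj n k' g
  have h1 : S.proj n k (S.Y n ω) - S.proj n k' (S.Y n ω)
      = (f - S.proj n k' f) + S.sigma • z := by
    rw [Y_eq, map_add, map_add, S.proj_fvec_of_mem h, map_smul, map_smul, smul_sub]
    abel
  have hz : ‖z‖ ≤ √α / 2 := by
    refine (norm_starProjection_sub_le (S.col_le hk) g).trans ?_
    rw [← Real.sqrt_sq (norm_nonneg _),
      show √α / 2 = √(α / 4) by
        rw [Real.sqrt_div hα, show (4 : ℝ) = 2 ^ 2 by norm_num, Real.sqrt_sq (by norm_num)]]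
    exact Real.sqrt_le_sqrt hω
  have hx : S.sigma * √α ≤ ‖f - S.proj n k' f‖ := by
    rw [le_div_iff₀ (by positivity), bias] at hbias
    rw [← Real.sqrt_sq (norm_nonneg (f - _)), ← Real.sqrt_sq hσ.le,
      ← Real.sqrt_mul (sq_nonneg _), mul_comm]
    exact Real.sqrt_le_sqrt hbias
  have h2 : S.sigma * (√α / 2) ≤ ‖(f - S.proj n k' f) + S.sigma • z‖ := by
    have h3 := norm_sub_le ((f - S.proj n k' f) + S.sigma • z) (S.sigma • z)
    rw [add_sub_cancel_right, norm_smul, Real.norm_of_nonneg hσ.le] at h3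
    have := mul_le_mul_of_nonneg_left hz hσ.le
    linarith
  rw [h1]
  calc S.sigma ^ 2 * (α / 4) = (S.sigma * (√α / 2)) ^ 2 := by
        rw [mul_pow, div_pow, Real.sq_sqrt hα]; norm_num
    _ ≤ _ := by gcongr

/-! ### Parametric scenario. -/

theorem tendsto_chiSq_deviation [IsProbabilityMeasure P] (k : (n : ℕ) → Γ n) {h : ℕ → ℝ}
    (hh : Tendsto h atTop atTop) :
    Tendsto (fun n => P {ω | h n * √n ≤
      |‖(S.col n (k n))ᗮ.starProjection (S.stdNoise n ω)‖ ^ 2 - (n - S.rk n (k n))|})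
      atTop (𝓝 0) := by
  have hlim : Tendsto (fun n => Real.exp (1 - h n) + Real.exp (1 / 4 - h n / 4)) atTop (𝓝 0) := by
    rw [← add_zero (0 : ℝ)]
    refine Tendsto.add (Real.tendsto_exp_atBot.comp ?_) (Real.tendsto_exp_atBot.comp ?_)
    · exact tendsto_atBot_add_const_left _ 1 (tendsto_neg_atTop_atBot.comp hh)
    · exact tendsto_atBot_add_const_left _ (1 / 4)
        (tendsto_neg_atTop_atBot.comp (hh.atTop_div_const (by norm_num)))
  refine tendsto_measure_zero_of_real_le ?_ hlim
  filter_upwards [eventually_ge_atTop 1] with n hn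
  have hn0 : (1 : ℝ) ≤ n := by exact_mod_cast hn
  have hs : 1 ≤ √(n : ℝ) := Real.one_le_sqrt.2 hn0
  have hs2 : √(n : ℝ) ^ 2 = n := Real.sq_sqrt (by linarith)
  have hm := S.finrank_col_orthogonal n (k n)
  have hmn : (Module.finrank ℝ (S.col n (k n))ᗮ : ℝ) ≤ n := by
    rw [hm]
    have : (0 : ℝ) ≤ S.rk n (k n) := by positivity
    linarith
  -- An exponent `t` of order `1/√n` keeps the quadratic term `m t²` bounded while the linear term
  -- is of order `h n`.
  have h1 := chiSq_lower_tail (S.stdNoise_hasLaw n) (S.col n (k n))ᗮ (y := h n * √n)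
    (t := 1 / √n) (by positivity)
  have h2 := chiSq_upper_tail (S.stdNoise_hasLaw n) (S.col n (k n))ᗮ (y := h n * √n)
    (t := 1 / (4 * √n)) (by positivity)
    (by rw [div_le_div_iff₀ (by positivity) (by norm_num)]; linarith)
  have h3 : -(1 / √n) * (h n * √n) + Module.finrank ℝ (S.col n (k n))ᗮ * (1 / √n) ^ 2
      ≤ 1 - h n := by
    have e1 : -(1 / √n) * (h n * √n) = - h n := by field_simp
    rw [e1, div_pow, hs2, mul_div_assoc', one_pow, mul_one]
    have := div_le_one_of_le₀ hmn (by linarith)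
    linarith
  have h4 : -(1 / (4 * √n)) * (h n * √n)
      + 4 * Module.finrank ℝ (S.col n (k n))ᗮ * (1 / (4 * √n)) ^ 2 ≤ 1 / 4 - h n / 4 := by
    have e1 : -(1 / (4 * √n)) * (h n * √n) = - h n / 4 := by field_simp
    have e2 : 4 * (Module.finrank ℝ (S.col n (k n))ᗮ : ℝ) * (1 / (4 * √n)) ^ 2
      = (Module.finrank ℝ (S.col n (k n))ᗮ : ℝ) / n / 4 := by
      rw [div_pow, mul_pow, hs2]; field_simp
    rw [e1, e2]
    have := div_le_one_of_le₀ hmn (by linarith)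
    linarith
  refine le_trans ?_ (add_le_add (h1.trans (Real.exp_le_exp.2 h3))
    (h2.trans (Real.exp_le_exp.2 h4)))
  refine (measureReal_mono ?_).trans (measureReal_union_le _ _)
  intro ω hω
  simp only [Set.mem_ofPred_eq, Set.mem_union, hm] at hω ⊢
  rcases le_abs.1 hω with h | h
  · right; linarith
  · left; linarith

theorem tendsto_fitted_noise [IsProbabilityMeasure P] (k : (n : ℕ) → Γ n) {u : ℕ → ℝ}
    (hu : Tendsto u atTop atTop) (hr : ∀ᶠ n in atTop, (S.rk n (k n) : ℝ) ≤ u n / 4) :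
    Tendsto (fun n => P {ω | u n ≤ ‖(S.col n (k n)).starProjection (S.stdNoise n ω)‖ ^ 2})
      atTop (𝓝 0) := by
  have hlim : Tendsto (fun n => Real.exp (-(u n / 16))) atTop (𝓝 0) :=
    Real.tendsto_exp_atBot.comp
      (tendsto_neg_atTop_atBot.comp (hu.atTop_div_const (by norm_num)))
  refine tendsto_measure_zero_of_real_le ?_ hlim
  filter_upwards [hr, hu.eventually_ge_atTop 0] with n hn hn0
  have h1 := chiSq_upper_tail (S.stdNoise_hasLaw n) (S.col n (k n))
    (y := u n - S.rk n (k n)) (t := 1 / 4) (by norm_num) le_rfl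
  rw [← rk_eq] at h1
  simp only [add_sub_cancel] at h1
  refine h1.trans (Real.exp_le_exp.2 ?_)
  linarith

/-- Since `r` and `λ log n` are both at least one, each is bounded by their product, hence is
`o(n^(1/2+τ))`; the last term uses `log n = o(n^τ)`. -/
theorem parametric_eventually {kstar : (n : ℕ) → Γ n} (hpar : S.Parametric kstar) {τ : ℝ}
    (hτ : 0 < τ) (hP2 : S.CondP2 kstar τ) {η : ℝ} (hη : 0 < η) :
    ∀ᶠ n : ℕ in atTop, S.truth n ∈ S.model n (kstar n) ∧ 1 < S.rk n (kstar n) ∧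
      1 ≤ S.lam n * Real.log n ∧ 1 ≤ n ∧
      S.rk n (kstar n) * (S.lam n * Real.log n) ≤ η * (n : ℝ) ^ (1 / 2 + τ) ∧
      (S.rk n (kstar n) : ℝ) ≤ η * (n : ℝ) ^ (1 / 2 + τ) ∧
      S.lam n * Real.log n ≤ η * (n : ℝ) ^ (1 / 2 + τ) ∧
      S.d * √n * Real.log n ≤ η * (n : ℝ) ^ (1 / 2 + τ) := by
  have hlog : ∀ᶠ n : ℕ in atTop, S.d * Real.log n ≤ η * (n : ℝ) ^ τ := by
    have h1 := (isLittleO_log_rpow_atTop hτ).comp_tendsto tendsto_natCast_atTop_atTop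
    have h2 := (h1.const_mul_left S.d).def hη
    filter_upwards [h2] with n hn
    simp only [Function.comp_apply] at hn
    refine (le_abs_self _).trans (hn.trans_eq ?_)
    rw [Real.norm_of_nonneg (by positivity)]
  filter_upwards [hpar, hP2.def hη, hlog, eventually_ge_atTop 2] with n h1 h2 h3 h4
  have hl := S.one_le_lam_mul_log h4
  have hr : (1 : ℝ) ≤ S.rk n (kstar n) := by exact_mod_cast h1.2.le
  have hn : (0 : ℝ) < n := by positivity
  have h5 : S.rk n (kstar n) * (S.lam n * Real.log n) ≤ η * (n : ℝ) ^ (1 / 2 + τ) := by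
    rw [Real.norm_of_nonneg (by positivity : (0 : ℝ) ≤ (n : ℝ) ^ (1 / 2 + τ))] at h2
    rw [← mul_assoc]
    exact (le_abs_self _).trans h2
  refine ⟨h1.1, h1.2, hl, by omega, h5, le_trans ?_ h5, le_trans ?_ h5, ?_⟩
  · nlinarith
  · nlinarith
  · rw [Real.rpow_add hn, ← Real.sqrt_eq_rpow]
    have := mul_le_mul_of_nonneg_left h3 (Real.sqrt_nonneg n)
    linarith

/-- The constant `c / (16 (K + 1))` makes `K` times the bound on the criterion, plus the penalty
unit, fit below `σ² c n^(1/2+τ) / 4`. Allowing every `s2 ≤ 3σ²/2` serves the known and the estimated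
variance at once. -/
theorem parametric_gap {kstar : (n : ℕ) → Γ n} (hpar : S.Parametric kstar) {τ c K : ℝ}
    (hτ : 0 < τ) (hc : 0 < c) (hK : 0 ≤ K)
    (hA : ∀ᶠ n : ℕ in atTop, c * (n : ℝ) ^ (1 / 2 + τ) ≤ S.A kstar n)
    (hP2 : S.CondP2 kstar τ) :
    ∀ᶠ n : ℕ in atTop, ∀ ω,
      ‖(S.col n (kstar n)).starProjection (S.stdNoise n ω)‖ ^ 2 < c / 4 * (n : ℝ) ^ (1 / 2 + τ) →
      ∀ s2 ≤ 3 / 2 * S.sigma ^ 2, ∀ k' ∈ S.S₁ n (kstar n),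
      K * (S.sigma ^ 2 * (3 * (c / (16 * (K + 1)) * (n : ℝ) ^ (1 / 2 + τ)))) ≤
        ‖S.proj n (kstar n) (S.Y n ω) - S.proj n k' (S.Y n ω)‖ ^ 2
          - S.lam n * Real.log n * s2 := by
  have hσ := S.sigma_pos
  filter_upwards [hA, S.parametric_eventually hpar hτ hP2
    (η := c / (16 * (K + 1))) (by positivity)] with n hAn hn ω hω s2 hs2 k' hk'
  obtain ⟨hmem, -, hl, -, -, -, hl2, -⟩ := hn
  set N := (n : ℝ) ^ (1 / 2 + τ)
  have hN : 0 ≤ N := by positivity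
  have hb : c * N ≤ S.bias n k' / S.sigma ^ 2 := by
    refine hAn.trans (ciInf_le (f := fun k : S.S₁ n (kstar n) => S.bias n k / S.sigma ^ 2)
      ⟨0, ?_⟩ ⟨k', hk'⟩)
    rintro _ ⟨k, rfl⟩
    exact div_nonneg (sq_nonneg _) (sq_nonneg _)
  have h1 := S.norm_proj_sub_ge hmem hk' (by positivity) hb (ω := ω) (by linarith)
  refine le_trans ?_ (sub_le_sub_right h1 _)
  set η := c / (16 * (K + 1)) with hηdef
  have hη : η * (K + 1) = c / 16 := by rw [hηdef]; field_simp
  have h2 : S.lam n * Real.log n * s2 ≤ η * N * (3 / 2 * S.sigma ^ 2) :=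
    (mul_le_mul_of_nonneg_left hs2 (by linarith)).trans
      (mul_le_mul_of_nonneg_right hl2 (by positivity))
  have hs : 0 ≤ S.sigma ^ 2 * N := by positivity
  have h3 : K * (S.sigma ^ 2 * (3 * (η * N))) + η * N * (3 / 2 * S.sigma ^ 2)
      + 3 / 2 * (η * (S.sigma ^ 2 * N))
      = 3 * (c / 16) * (S.sigma ^ 2 * N) := by rw [← hη]; ring
  have h4 : 0 ≤ η * (S.sigma ^ 2 * N) := by positivity
  have h5 : 0 ≤ c * (S.sigma ^ 2 * N) := by positivity
  linarith

section Probability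

variable {kstar : (n : ℕ) → Γ n} {τ c : ℝ}

theorem tendsto_rpow_mul_atTop {c τ : ℝ} (hc : 0 < c) (hτ : 0 < τ) :
    Tendsto (fun n : ℕ => c * (n : ℝ) ^ τ) atTop atTop :=
  ((tendsto_rpow_atTop hτ).comp tendsto_natCast_atTop_atTop).const_mul_atTop hc

theorem tendsto_not_selected [IsProbabilityMeasure P] (hsel : S.SelectionConsistent kstar) :
    Tendsto (fun n => P {ω | S.selected n ω = kstar n}ᶜ) atTop (𝓝 0) :=
  tendsto_measure_compl (fun n => S.selected_measurable n _) hsel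

theorem tendsto_fitted_noise_of_parametric [IsProbabilityMeasure P] (hpar : S.Parametric kstar) (hτ : 0 < τ) (hc : 0 < c)
    (hP2 : S.CondP2 kstar τ) :
    Tendsto (fun n : ℕ => P {ω | c / 4 * (n : ℝ) ^ (1 / 2 + τ) ≤
      ‖(S.col n (kstar n)).starProjection (S.stdNoise n ω)‖ ^ 2}) atTop (𝓝 0) := by
  refine S.tendsto_fitted_noise kstar (u := fun n => c / 4 * (n : ℝ) ^ (1 / 2 + τ))
    (tendsto_rpow_mul_atTop (by positivity) (by positivity)) ?_
  filter_upwards [S.parametric_eventually hpar hτ hP2 (η := c / 16) (by positivity)] with n hn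
  have := hn.2.2.2.2.2.1
  linarith

/-- With `τ ≤ 1/2`, `n^(1/2+τ) ≤ n`. This leaves at least `n/2` residual degrees of freedom. -/
theorem two_mul_rk_le_eventually (hpar : S.Parametric kstar) (hτ : 0 < τ) (hτ2 : τ ≤ 1 / 2)
    (hP2 : S.CondP2 kstar τ) : ∀ᶠ n in atTop, 2 * (S.rk n (kstar n) : ℝ) ≤ n := by
  filter_upwards [S.parametric_eventually hpar hτ hP2 (η := 1 / 2) (by positivity)] with n hn
  have h1 : (1 : ℝ) ≤ n := by exact_mod_cast hn.2.2.2.1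
  have h2 : (n : ℝ) ^ (1 / 2 + τ) ≤ (n : ℝ) ^ (1 : ℝ) :=
    Real.rpow_le_rpow_of_exponent_le h1 (by linarith)
  rw [Real.rpow_one] at h2
  have := hn.2.2.2.2.2.1
  linarith

theorem rpow_half_add (n : ℕ) (hn : 1 ≤ n) : (n : ℝ) ^ (1 / 2 + τ) = (n : ℝ) ^ τ * √n := by
  rw [Real.rpow_add (by positivity), ← Real.sqrt_eq_rpow, mul_comm]

/-- The criterion of the true model is of smaller order than the squared bias of its
submodels. -/
theorem abs_IC_le_eventually (hpar : S.Parametric kstar) (hτ : 0 < τ) (hP2 : S.CondP2 kstar τ)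
    {η : ℝ} (hη : 0 < η) :
    ∀ᶠ n : ℕ in atTop, ∀ ω,
      |‖(S.col n (kstar n))ᗮ.starProjection (S.stdNoise n ω)‖ ^ 2 - (n - S.rk n (kstar n))|
        < η * (n : ℝ) ^ τ * √n →
      |S.IC (S.sigma ^ 2) n (kstar n) ω| ≤ S.sigma ^ 2 * (3 * (η * (n : ℝ) ^ (1 / 2 + τ))) := by
  have hσ := S.sigma_pos
  filter_upwards [S.parametric_eventually hpar hτ hP2 hη] with n hn ω hω
  obtain ⟨hmem, hr, hl, hn1, h1, h2, h3, h4⟩ := hn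
  rw [mul_assoc, ← rpow_half_add n hn1] at hω
  rw [S.IC_sigma_of_mem hmem, abs_mul, abs_of_pos (by positivity : 0 < S.sigma ^ 2)]
  gcongr
  refine (abs_add_le _ _).trans ?_
  have h5 : 0 ≤ (S.lam n * Real.log n - 1) * S.rk n (kstar n) :=
    mul_nonneg (by linarith) (by positivity)
  have h6 : 0 ≤ S.d * √n * Real.log n :=
    mul_nonneg (mul_nonneg S.d_nonneg (Real.sqrt_nonneg _)) (Real.log_natCast_nonneg n)
  rw [abs_of_nonneg (add_nonneg h5 h6)]
  have : (0 : ℝ) ≤ S.rk n (kstar n) := by positivity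
  linarith

theorem tendstoInProb_abs_PI [IsProbabilityMeasure P] (hpar : S.Parametric kstar) (hsel : S.SelectionConsistent kstar)
    (hτ : 0 < τ) (hτ2 : τ ≤ 1 / 2) (hP1 : S.CondP1 kstar τ) (hP2 : S.CondP2 kstar τ) :
    TendstoInProbAtTop P (fun n ω => |S.PI n ω|) := by
  intro M
  obtain ⟨c, hc, hA⟩ := hP1
  have hσ := S.sigma_pos
  set K := |M| + 2 with hK
  have hK0 : 0 < K := by positivity
  set η := c / (16 * (K + 1))
  have hη : 0 < η := by positivity
  -- A vanishing denominator would make the quotients zero by convention. It is a null event, being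
  -- a level set of a chi-square with positive degrees of freedom.
  have hnull : Tendsto (fun n => P {ω | S.IC (S.sigma ^ 2) n (kstar n) ω = 0}) atTop (𝓝 0) := by
    refine tendsto_const_nhds.congr' ?_
    filter_upwards [hpar, S.two_mul_rk_le_eventually hpar hτ hτ2 hP2] with n hn hn2
    have h1 : 0 < Module.finrank ℝ (S.col n (kstar n))ᗮ := by
      have h2 := S.finrank_col_orthogonal n (kstar n)
      have h3 : (1 : ℝ) < S.rk n (kstar n) := by exact_mod_cast hn.2
      have h4 : (0 : ℝ) < Module.finrank ℝ (S.col n (kstar n))ᗮ := by linarith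
      exact_mod_cast h4
    rw [eq_comm, ← nonpos_iff_eq_zero,
      ← starProjection_norm_sq_eq_null (S.stdNoise_hasLaw n) _ h1
        ((n - S.rk n (kstar n)) - ((S.lam n * Real.log n - 1) * S.rk n (kstar n)
        + S.d * Real.sqrt n * Real.log n))]
    refine measure_mono fun ω hω => ?_
    simp only [Set.mem_ofPred_eq] at hω ⊢
    rw [S.IC_sigma_of_mem hn.1, mul_eq_zero_iff_left (by positivity)] at hω
    linarith
  refine tendsto_measure_one_of_bad (tendsto_measure_union (tendsto_measure_union
    (tendsto_measure_union (S.tendsto_not_selected hsel) hnull)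
    (S.tendsto_fitted_noise_of_parametric hpar hτ hc hP2))
    (S.tendsto_chiSq_deviation kstar (tendsto_rpow_mul_atTop hη hτ))) ?_
  filter_upwards [hpar, S.parametric_gap hpar hτ hc hK0.le hA hP2,
    S.abs_IC_le_eventually hpar hτ hP2 hη] with n hn hgap hIC ω hω
  simp only [Set.mem_union, Set.mem_compl_iff, Set.mem_ofPred_eq, not_or, not_not, not_le] at hω ⊢
  obtain ⟨⟨⟨h1, h2⟩, h3⟩, h4⟩ := hω
  have hgap' := hgap ω h3 (S.sigma ^ 2) (by nlinarith)
  have hIC' := hIC ω h4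
  have hM := le_abs_self M
  rw [← h1] at h2 hgap' hIC'
  have hr : 1 < S.rk n (S.selected n ω) := by rw [h1]; exact hn.2
  rcases lt_or_gt_of_ne h2 with hneg | hpos
  · have := S.PIwith_le_of_neg (K := K) hr hneg fun k' hk' =>
      (mul_le_mul_of_nonneg_left ((neg_le_abs _).trans hIC') hK0.le).trans (hgap' k' hk')
    refine lt_of_lt_of_le ?_ (neg_le_abs _)
    rw [PI]
    linarith
  · have := S.le_PIwith (K := K) hr hpos fun k' hk' =>
      (mul_le_mul_of_nonneg_left ((le_abs_self _).trans hIC') hK0.le).trans (hgap' k' hk')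
    refine lt_of_lt_of_le ?_ (le_abs_self _)
    rw [PI]
    linarith

theorem tendstoInProb_PI [IsProbabilityMeasure P] (hpar : S.Parametric kstar) (hsel : S.SelectionConsistent kstar)
    (hτ : 0 < τ) (hP1 : S.CondP1 kstar τ) (hP2 : S.CondP2 kstar τ)
    (hpen : Tendsto (fun n : ℕ => ((S.lam n * Real.log n - 1) * S.rk n (kstar n)
      + S.d * Real.sqrt n * Real.log n) / Real.sqrt n) atTop atTop) :
    TendstoInProbAtTop P S.PI := by
  intro M
  obtain ⟨c, hc, hA⟩ := hP1
  have hσ := S.sigma_pos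
  set K := |M| + 2 with hK
  have hK0 : 0 < K := by positivity
  set η := c / (16 * (K + 1))
  have hη : 0 < η := by positivity
  refine tendsto_measure_one_of_bad (tendsto_measure_union (tendsto_measure_union
    (tendsto_measure_union (S.tendsto_not_selected hsel) (S.tendsto_chiSq_deviation kstar hpen))
    (S.tendsto_fitted_noise_of_parametric hpar hτ hc hP2))
    (S.tendsto_chiSq_deviation kstar (tendsto_rpow_mul_atTop hη hτ))) ?_
  filter_upwards [hpar, S.parametric_gap hpar hτ hc hK0.le hA hP2,
    S.abs_IC_le_eventually hpar hτ hP2 hη, eventually_ge_atTop 1] with n hn hgap hIC hn1 ω hω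
  simp only [Set.mem_union, Set.mem_compl_iff, Set.mem_ofPred_eq, not_or, not_not, not_le] at hω ⊢
  obtain ⟨⟨⟨h1, h2⟩, h3⟩, h4⟩ := hω
  have hgap' := hgap ω h3 (S.sigma ^ 2) (by nlinarith)
  have hIC' := hIC ω h4
  have hM := le_abs_self M
  -- The penalty over `√n` was itself taken as the deviation level, so the fluctuation stays
  -- strictly below the penalty.
  have hpos : 0 < S.IC (S.sigma ^ 2) n (kstar n) ω := by
    have : (0 : ℝ) < √n := Real.sqrt_pos.2 (by exact_mod_cast hn1)
    rw [div_mul_cancel₀ _ this.ne'] at h2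
    rw [S.IC_sigma_of_mem hn.1]
    refine mul_pos (by positivity) ?_
    linarith [neg_abs_le (‖(S.col n (kstar n))ᗮ.starProjection (S.stdNoise n ω)‖ ^ 2
      - (n - S.rk n (kstar n)))]
  rw [← h1] at hpos hgap' hIC'
  have hr : 1 < S.rk n (S.selected n ω) := by rw [h1]; exact hn.2
  have := S.le_PIwith (K := K) hr hpos fun k' hk' =>
    (mul_le_mul_of_nonneg_left ((le_abs_self _).trans hIC') hK0.le).trans (hgap' k' hk')
  rw [PI]
  linarith

theorem tendsto_penalty_of_d_pos (hd : 0 < S.d) (k : (n : ℕ) → Γ n) :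
    Tendsto (fun n : ℕ => ((S.lam n * Real.log n - 1) * S.rk n (k n)
      + S.d * Real.sqrt n * Real.log n) / Real.sqrt n) atTop atTop := by
  have h1 : Tendsto (fun n : ℕ => S.d * Real.log n) atTop atTop :=
    (Real.tendsto_log_atTop.comp tendsto_natCast_atTop_atTop).const_mul_atTop hd
  refine tendsto_atTop_mono' _ ?_ h1
  filter_upwards [eventually_ge_atTop 2] with n hn
  have hs : (0 : ℝ) < √n := Real.sqrt_pos.2 (by positivity)
  rw [le_div_iff₀ hs]
  have := mul_nonneg (sub_nonneg.2 (S.one_le_lam_mul_log hn)) (Nat.cast_nonneg (S.rk n (k n)))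
  linarith

theorem tendstoInProb_PIhat [IsProbabilityMeasure P] (hpar : S.Parametric kstar) (hsel : S.SelectionConsistent kstar)
    (hτ : 0 < τ) (hτ2 : τ ≤ 1 / 2) (hP1 : S.CondP1 kstar τ) (hP2 : S.CondP2 kstar τ)
    (hpen : ∀ᶠ n : ℕ in atTop, 1 < S.lam n * Real.log n ∨ 0 < S.d) :
    TendstoInProbAtTop P S.PIhat := by
  intro M
  obtain ⟨c, hc, hA⟩ := hP1
  have hσ := S.sigma_pos
  set K := |M| + 2 with hK
  have hK0 : 0 < K := by positivity
  set η := c / (16 * (K + 1))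
  have hη : 0 < η := by positivity
  -- This level gives the threshold `n/4`, at most half of `n - r`, so `σ̂²/σ²` lies between `1/2`
  -- and `3/2`.
  have hsqrt : Tendsto (fun n : ℕ => √(n : ℝ) / 4) atTop atTop :=
    (Real.tendsto_sqrt_atTop.comp tendsto_natCast_atTop_atTop).atTop_div_const (by norm_num)
  refine tendsto_measure_one_of_bad (tendsto_measure_union
    (tendsto_measure_union (S.tendsto_not_selected hsel) (S.tendsto_chiSq_deviation kstar hsqrt))
    (S.tendsto_fitted_noise_of_parametric hpar hτ hc hP2)) ?_
  filter_upwards [S.parametric_gap hpar hτ hc hK0.le hA hP2,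
    S.parametric_eventually hpar hτ hP2 hη, S.two_mul_rk_le_eventually hpar hτ hτ2 hP2,
    hpen, eventually_ge_atTop 2] with n hgap hn hrn hpen hn2 ω hω
  simp only [Set.mem_union, Set.mem_compl_iff, Set.mem_ofPred_eq, not_or, not_not, not_le] at hω ⊢
  obtain ⟨⟨h1, h2⟩, h3⟩ := hω
  obtain ⟨hmem, hr, hl, hn1, hrl, -, -, hdn⟩ := hn
  set Q := ‖(S.col n (kstar n))ᗮ.starProjection (S.stdNoise n ω)‖ ^ 2
  set N := (n : ℝ) ^ (1 / 2 + τ)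
  set m : ℝ := n - S.rk n (kstar n) with hm
  have hr0 : (1 : ℝ) < S.rk n (kstar n) := by exact_mod_cast hr
  have hs : √(n : ℝ) / 4 * √n = n / 4 := by
    rw [div_mul_eq_mul_div, Real.mul_self_sqrt (by positivity)]
  have hm0 : 0 < m := by linarith
  rw [hs, abs_lt] at h2
  set s2 := S.sigmaHatSq n ω with hs2def
  have hs2 : s2 = S.sigma ^ 2 * (Q / m) := by
    rw [hs2def, sigmaHatSq, h1, S.rss_of_mem hmem, mul_div_assoc]
  have hrss : S.rss n (kstar n) ω = s2 * m := by
    rw [hs2, S.rss_of_mem hmem]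
    field_simp
    rfl
  have hQ1 : 0 < Q / m := div_pos (by linarith) hm0
  have hQ2 : Q / m ≤ 3 / 2 := by rw [div_le_iff₀ hm0]; linarith
  have hs20 : 0 < s2 := by rw [hs2]; positivity
  have hs2le : s2 ≤ 3 / 2 * S.sigma ^ 2 := by rw [hs2, mul_comm]; gcongr
  -- The residual sum is exactly `σ̂² (n - r)`, so no fluctuation is left and the sign is that of
  -- the penalty.
  have hICeq : S.IC s2 n (kstar n) ω
      = s2 * ((S.lam n * Real.log n - 1) * S.rk n (kstar n) + S.d * √n * Real.log n) := by
    rw [IC, hrss, hm]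
    ring
  have hlog : 0 < Real.log n := Real.log_pos (by exact_mod_cast hn2)
  have hsq : 0 < √(n : ℝ) := Real.sqrt_pos.2 (by positivity)
  have hpen0 : 0 < (S.lam n * Real.log n - 1) * S.rk n (kstar n) + S.d * √n * Real.log n := by
    rcases hpen with h | h
    · have := S.d_nonneg
      have : 0 < (S.lam n * Real.log n - 1) * S.rk n (kstar n) :=
        mul_pos (by linarith) (by linarith)
      positivity
    · have : 0 ≤ (S.lam n * Real.log n - 1) * S.rk n (kstar n) :=
        mul_nonneg (by linarith) (by linarith)
      positivity
  have hpos : 0 < S.IC s2 n (kstar n) ω := by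
    rw [hICeq]
    exact mul_pos hs20 hpen0
  have hICle : S.IC s2 n (kstar n) ω ≤ S.sigma ^ 2 * (3 * (η * N)) := by
    rw [hICeq]
    refine (mul_le_mul (d := 2 * (η * N)) hs2le (by linarith) hpen0.le (by positivity)).trans_eq ?_
    ring
  have hgap' := hgap ω h3 s2 hs2le
  have hM := le_abs_self M
  rw [← h1] at hpos hgap' hICle hr
  have := S.le_PIwith (K := K) hr hpos fun k' hk' =>
    (mul_le_mul_of_nonneg_left hICle hK0.le).trans (hgap' k' hk')
  rw [PIhat]
  linarith

end Probability

end Setting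

/-! ### Nonparametric scenario: union bound over the candidates. -/

theorem measure_biUnion_le_encard_mul {Ω ι : Type*} [MeasurableSpace Ω] [Countable ι]
    {P : Measure Ω} (T : Set ι) (E : ι → Set Ω) {c : ℝ≥0∞} (h : ∀ k ∈ T, P (E k) ≤ c) :
    P (⋃ k ∈ T, E k) ≤ (T.encard : ℝ≥0∞) * c := by
  refine (measure_biUnion_le P T.to_countable E).trans ?_
  rw [← ENNReal.tsum_set_const]
  exact ENNReal.tsum_le_tsum fun k => h k k.2

namespace Setting

variable {Ω : Type*} [MeasurableSpace Ω] {P : Measure Ω} {𝒳 : Type*} {Γ : ℕ → Type*}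
  (S : Setting P 𝒳 Γ)

theorem penalty_le_D {n : ℕ} (k : Γ n) :
    (S.lam n * Real.log n - 1) * S.rk n k ≤ S.D n k := by
  have h1 : 0 ≤ S.bias n k / S.sigma ^ 2 := div_nonneg (sq_nonneg _) (sq_nonneg _)
  have h2 : 0 ≤ S.d * √n * Real.log n :=
    mul_nonneg (mul_nonneg S.d_nonneg (Real.sqrt_nonneg _)) (Real.log_natCast_nonneg n)
  rw [D]
  linarith

theorem penalty_nonneg {n : ℕ} (hn : 2 ≤ n) (k : Γ n) :
    0 ≤ (S.lam n * Real.log n - 1) * S.rk n k :=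
  mul_nonneg (sub_nonneg.2 (S.one_le_lam_mul_log hn)) (Nat.cast_nonneg _)

theorem D_nonneg {n : ℕ} (hn : 2 ≤ n) (k : Γ n) : 0 ≤ S.D n k :=
  (S.penalty_nonneg hn k).trans (S.penalty_le_D k)

theorem bias_le_D {n : ℕ} (hn : 2 ≤ n) (k : Γ n) : S.bias n k / S.sigma ^ 2 ≤ S.D n k := by
  have h2 : 0 ≤ S.d * √n * Real.log n :=
    mul_nonneg (mul_nonneg S.d_nonneg (Real.sqrt_nonneg _)) (Real.log_natCast_nonneg n)
  have h3 := S.penalty_nonneg hn k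
  rw [D]
  linarith

theorem B_nonneg {n : ℕ} (hn : 2 ≤ n) (j : ℕ) : 0 ≤ S.B j n :=
  Real.iInf_nonneg fun k => S.D_nonneg hn k

theorem B_le_D {n : ℕ} (hn : 2 ≤ n) (k : Γ n) : S.B (S.rk n k) n ≤ S.D n k := by
  refine ciInf_le (f := fun k' : {k' : Γ n // S.rk n k' = S.rk n k} => S.D n k') ⟨0, ?_⟩ ⟨k, rfl⟩
  rintro _ ⟨k', rfl⟩
  exact S.D_nonneg hn k'

theorem N_le_N_mul_L {n j : ℕ} (hj : 1 < j) : S.N n j ≤ S.N n j * S.L n j := by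
  rcases Set.eq_empty_or_nonempty {k : Γ n | S.rk n k = j} with h | ⟨k, hk⟩
  · simp [N, h]
  · refine le_mul_of_one_le_right' ?_
    have h1 : (S.S₁ n k).Nonempty := S.subModels_nonempty n k (by
      change 1 < S.rk n k
      rwa [show S.rk n k = j from hk])
    refine (Set.one_le_encard_iff_nonempty.2 h1).trans ?_
    exact le_iSup (fun k : {k : Γ n // S.rk n k = j} => Set.encard (S.S₁ n k)) ⟨k, hk⟩

/-- The event that, for model `k`, the criterion falls below a fixed fraction of its target
`D`, or the noise explained by `k` but not by `k'` exceeds the fraction `δ` of it. -/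
def badEvent (δ : ℝ) (n : ℕ) (k k' : Γ n) : Set Ω :=
  {ω | ‖(S.col n k)ᗮ.starProjection (S.stdNoise n ω)‖ ^ 2
      ≤ Module.finrank ℝ (S.col n k)ᗮ - 9 / 10 * S.D n k}
  ∪ {ω | 1 / 40 * S.D n k
      ≤ inner ℝ (-(S.sigma⁻¹ • (S.fvec n - S.proj n k (S.fvec n)))) (S.stdNoise n ω)}
  ∪ {ω | δ * S.D n k ≤ ‖((S.col n k')ᗮ ⊓ S.col n k).starProjection (S.stdNoise n ω)‖ ^ 2}

theorem measure_badEvent_le [IsProbabilityMeasure P] {δ : ℝ} {n : ℕ} (hn : 2 ≤ n)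
    {k k' : Γ n} (hk : k' ∈ S.S₁ n k) (hr : S.rk n k < n) (hD : 0 < S.D n k) :
    P.real (S.badEvent δ n k k') ≤ Real.exp (-(S.D n k ^ 2 / (5 * (n - S.rk n k))))
      + Real.exp (-(S.D n k / 3200)) + 2 * Real.exp (-(δ * S.D n k / 4)) := by
  have hG := S.stdNoise_hasLaw n
  have hσ := S.sigma_pos
  have hm0 : (0 : ℝ) < n - S.rk n k := sub_pos.2 (by exact_mod_cast hr)
  refine (measureReal_union_le _ _).trans
    (add_le_add ((measureReal_union_le _ _).trans (add_le_add ?_ ?_)) ?_)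
  -- The exponent `y / (2m)` minimises `-ty + mt²`, and `(9/10)² / 4 = 81/400` just exceeds `1/5`.
  · refine (chiSq_lower_tail hG (S.col n k)ᗮ
      (t := 9 / 10 * S.D n k / (2 * (n - S.rk n k))) (by positivity)).trans
      (Real.exp_le_exp.2 ?_)
    rw [S.finrank_col_orthogonal]
    set m : ℝ := n - S.rk n k
    have e : -(9 / 10 * S.D n k / (2 * m)) * (9 / 10 * S.D n k)
        + m * (9 / 10 * S.D n k / (2 * m)) ^ 2 = -(81 / 400 * (S.D n k ^ 2 / m)) := by
      field_simp
      ring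
    have e2 : S.D n k ^ 2 / (5 * m) = 1 / 5 * (S.D n k ^ 2 / m) := by field_simp
    rw [e, e2]
    have : 0 ≤ S.D n k ^ 2 / m := by positivity
    linarith
  -- The variance is the scaled bias, at most `D`, so the exponent is `(D/40)² / (2D) = D/3200`.
  · refine (inner_tail hG _ (by positivity) hD (y := 1 / 40 * S.D n k) ?_).trans
      (Real.exp_le_exp.2 ?_)
    · rw [norm_neg, norm_smul, mul_pow, Real.norm_eq_abs, sq_abs]
      refine le_trans (le_of_eq ?_) (S.bias_le_D hn k)
      rw [bias, inv_pow, inv_mul_eq_div]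
    · apply le_of_eq
      field_simp
      norm_num
  · have h1 := chiSq_upper_tail hG ((S.col n k')ᗮ ⊓ S.col n k) (y := δ * S.D n k - 1)
      (t := 1 / 4) (by norm_num) le_rfl
    rw [S.finrank_orthogonal_inf_col hk] at h1
    simp only [Nat.cast_one, add_sub_cancel] at h1
    refine h1.trans ?_
    have h2 : Real.exp (1 / 2) ≤ 2 := by
      have := Real.exp_bound_div_one_sub_of_interval (x := 1 / 2) (by norm_num) (by norm_num)
      norm_num at this ⊢
      exact this
    calc _ = Real.exp (1 / 2) * Real.exp (-(δ * S.D n k / 4)) := by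
          rw [← Real.exp_add]; congr 1; ring
      _ ≤ _ := by gcongr

/-- The total probability of the bad events of the models of rank `j`. -/
theorem measure_iUnion_badEvent_le [IsProbabilityMeasure P] [∀ n, Countable (Γ n)]
    {δ γ ζ c₀ : ℝ} (hc₀ : 0 < c₀) (hγ : γ ≤ 1 / 3200) (hγδ : γ ≤ δ / 4) (hζ : ζ ≤ γ / 2)
    {n j : ℕ} (hn : 2 ≤ n) (hj1 : 1 < j) (hjn : j < n) {sub : Γ n → Γ n}
    (hsub : ∀ k, S.rk n k = j → sub k ∈ S.S₁ n k) (hB : 0 < S.B j n)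
    (hBm : S.B j n / (n - j) ≤ 5 * γ)
    (hNL : ((S.N n j * S.L n j : ℕ∞) : ℝ≥0∞) ≤ ENNReal.ofReal (c₀ * Real.exp (ζ * S.B j n)))
    (hN : (S.N n j : ℝ≥0∞) ≤
        ENNReal.ofReal (c₀ * Real.exp (S.B j n ^ 2 / (10 * ((n : ℝ) - j))))) :
    P (⋃ k ∈ {k : Γ n | S.rk n k = j}, S.badEvent δ n k (sub k)) ≤
      ENNReal.ofReal (4 * c₀ * Real.exp (-(S.B j n ^ 2 / (10 * ((n : ℝ) - j))))) := by
  have hm0 : (0 : ℝ) < n - j := sub_pos.2 (by exact_mod_cast hjn)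
  set b := S.B j n with hb
  set x := b ^ 2 / (10 * ((n : ℝ) - j)) with hx
  -- Together with `ζ ≤ γ/2` this gives `e^{ζb - γb} ≤ e^{-x}`, so both kinds of tail end up with
  -- the same summable factor.
  have hxb : x ≤ γ / 2 * b := by
    have : x = b / (n - j) * b / 10 := by rw [hx]; field_simp
    rw [this]
    have := mul_le_mul_of_nonneg_right hBm hB.le
    linarith
  have hγ0 : 0 ≤ γ := by
    have : 0 < b / (n - j) := by positivity
    linarith
  have h1 : ∀ k ∈ {k : Γ n | S.rk n k = j}, P (S.badEvent δ n k (sub k)) ≤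
      ENNReal.ofReal (Real.exp (-(2 * x))) + ENNReal.ofReal (3 * Real.exp (-(γ * b))) := by
    intro k hk
    have hk' : S.rk n k = j := hk
    have hbD : b ≤ S.D n k := by rw [hb, ← hk']; exact S.B_le_D hn k
    have hD : 0 < S.D n k := hB.trans_le hbD
    rw [← ENNReal.ofReal_add (by positivity) (by positivity), ← ofReal_measureReal]
    refine ENNReal.ofReal_le_ofReal
      ((S.measure_badEvent_le hn (hsub k hk) (hk'.trans_lt hjn) hD).trans ?_)
    rw [hk']
    have e1 : Real.exp (-(S.D n k ^ 2 / (5 * (n - j)))) ≤ Real.exp (-(2 * x)) := by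
      apply Real.exp_le_exp.2
      have : 2 * x = b ^ 2 / (5 * (n - j)) := by rw [hx]; field_simp; norm_num
      rw [this]
      gcongr
    have e2 : Real.exp (-(S.D n k / 3200)) ≤ Real.exp (-(γ * b)) := by
      apply Real.exp_le_exp.2
      have := mul_le_mul hγ hbD hB.le (by norm_num)
      linarith
    have e3 : Real.exp (-(δ * S.D n k / 4)) ≤ Real.exp (-(γ * b)) := by
      apply Real.exp_le_exp.2
      have := mul_le_mul hγδ hbD hB.le (by linarith)
      linarith
    linarith
  refine (measure_biUnion_le_encard_mul _ _ h1).trans ?_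
  change (S.N n j : ℝ≥0∞) * _ ≤ _
  have hN2 : (S.N n j : ℝ≥0∞) ≤ ENNReal.ofReal (c₀ * Real.exp (ζ * b)) :=
    (ENat.toENNReal_mono (S.N_le_N_mul_L hj1)).trans hNL
  rw [mul_add]
  -- The chi-square tail `e^{-2x}` spends one factor on the bound `e^x` for `N_j`; the other tails
  -- are paired with the bound `e^{ζb}`.
  refine (add_le_add (mul_le_mul_left hN _) (mul_le_mul_left hN2 _)).trans ?_
  rw [← ENNReal.ofReal_mul (by positivity), ← ENNReal.ofReal_mul (by positivity),
    ← ENNReal.ofReal_add (by positivity) (by positivity)]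
  apply ENNReal.ofReal_le_ofReal
  have e1 : c₀ * Real.exp x * Real.exp (-(2 * x)) = c₀ * Real.exp (-x) := by
    rw [mul_assoc, ← Real.exp_add]; congr 2; ring
  have e2 : c₀ * Real.exp (ζ * b) * (3 * Real.exp (-(γ * b))) ≤ 3 * c₀ * Real.exp (-x) := by
    have : c₀ * Real.exp (ζ * b) * (3 * Real.exp (-(γ * b)))
      = 3 * c₀ * Real.exp (ζ * b + -(γ * b)) := by rw [Real.exp_add]; ring
    rw [this]
    gcongr
    have := mul_le_mul_of_nonneg_right hζ hB.le
    linarith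
  rw [e1]
  linarith

/-- Outside the bad event of the selected model the index is close to one. -/
theorem abs_PI_sub_one_le {δ : ℝ} (hδ : 0 ≤ δ) {n : ℕ} {k' : Γ n} {ω : Ω}
    (hr : 1 < S.rk n (S.selected n ω)) (hk' : k' ∈ S.S₁ n (S.selected n ω))
    (hD : 0 < S.D n (S.selected n ω))
    (hl0 : 0 ≤ S.lam n * Real.log n)
    (hl : S.lam n * Real.log n ≤ δ * S.D n (S.selected n ω))
    (hf : ‖S.proj n (S.selected n ω) (S.fvec n) - S.proj n k' (S.fvec n)‖ ^ 2
      ≤ S.sigma ^ 2 * δ * S.D n (S.selected n ω))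
    (hω : ω ∉ S.badEvent δ n (S.selected n ω) k') :
    |S.PI n ω - 1| ≤ 80 * δ := by
  have hσ := S.sigma_pos
  simp only [badEvent, Set.mem_union, Set.mem_ofPred_eq, not_or, not_le] at hω
  obtain ⟨⟨h1, h2⟩, h3⟩ := hω
  rw [inner_neg_left] at h2
  rw [S.finrank_col_orthogonal] at h1
  set k := S.selected n ω
  -- What remains of `D` is the fraction `1 - 9/10 - 2/40 = 1/20`.
  have hIC : S.sigma ^ 2 * (1 / 20 * S.D n k) ≤ S.IC (S.sigma ^ 2) n k ω := by
    rw [IC_sigma_eq]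
    gcongr
    linarith
  have hpos : 0 < S.IC (S.sigma ^ 2) n k ω := lt_of_lt_of_le (by positivity) hIC
  have hdiff : ‖S.proj n k (S.Y n ω) - S.proj n k' (S.Y n ω)‖ ^ 2
      ≤ 4 * (S.sigma ^ 2 * (δ * S.D n k)) := by
    have e : S.proj n k (S.Y n ω) - S.proj n k' (S.Y n ω)
        = (S.proj n k (S.fvec n) - S.proj n k' (S.fvec n))
          + S.sigma • ((S.col n k')ᗮ ⊓ S.col n k).starProjection (S.stdNoise n ω) := by
      rw [← starProjection_sub_of_le (S.col_le hk'), Y_eq, map_add, map_add, map_smul, map_smul,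
        smul_sub, proj_eq, proj_eq]
      abel
    rw [e]
    set p := S.proj n k (S.fvec n) - S.proj n k' (S.fvec n)
    set q := S.sigma • ((S.col n k')ᗮ ⊓ S.col n k).starProjection (S.stdNoise n ω) with hq
    have hq2 : ‖q‖ ^ 2 ≤ S.sigma ^ 2 * (δ * S.D n k) := by
      rw [hq, norm_smul, mul_pow, Real.norm_eq_abs, sq_abs]
      gcongr
    have h4 : ‖p + q‖ ^ 2 ≤ (‖p‖ + ‖q‖) ^ 2 := by gcongr; exact norm_add_le _ _
    linarith [sq_nonneg (‖p‖ - ‖q‖)]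
  -- One submodel suffices above, with `80 = 4 · 20`; the lower bound below holds for every submodel
  -- because the squared norm is simply dropped.
  have hupper := S.PIwith_le (K := 80 * δ) hr hpos hk' (by
    have h5 := mul_le_mul_of_nonneg_left hIC (by positivity : 0 ≤ 80 * δ)
    have h6 : 0 ≤ S.lam n * Real.log n * S.sigma ^ 2 := by positivity
    linarith)
  have hlower := S.le_PIwith (K := -(80 * δ)) hr hpos fun k'' hk'' => by
    have h5 := mul_le_mul_of_nonneg_left hIC (by positivity : 0 ≤ 80 * δ)
    have h6 := mul_le_mul_of_nonneg_right hl (sq_nonneg S.sigma)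
    have h7 := sq_nonneg ‖S.proj n k (S.Y n ω) - S.proj n k'' (S.Y n ω)‖
    have h8 : 0 ≤ S.sigma ^ 2 * (δ * S.D n k) := by positivity
    linarith
  rw [abs_le, PI]
  constructor <;> linarith

section Nonparametric

variable {a b : ℕ → ℕ}

theorem B_div_le_eventually
    (hN1 : Tendsto (fun n => ⨆ j : Set.Icc (a n) (b n), S.B j n / ((n : ℝ) - (j : ℕ)))
      atTop (𝓝 0)) {ε : ℝ} (hε : 0 < ε) :
    ∀ᶠ n : ℕ in atTop, ∀ j ∈ Set.Icc (a n) (b n), S.B j n / ((n : ℝ) - j) ≤ ε := by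
  filter_upwards [hN1.eventually_lt_const hε] with n hn j hj
  exact (le_ciSup (f := fun j : Set.Icc (a n) (b n) => S.B j n / ((n : ℝ) - (j : ℕ)))
    (Set.finite_range _).bddAbove ⟨j, hj⟩).trans hn.le

/-- A summand below `e^{-1}` forces `B² > 10(n - j)`, while `B/(n - j) ≤ 10/K` gives `10(n - j) ≥
KB`; hence `B > K`. -/
theorem le_B_eventually (hab : ∀ᶠ n in atTop, 1 ≤ a n ∧ a n < b n ∧ b n < n)
    (hN1 : Tendsto (fun n => ⨆ j : Set.Icc (a n) (b n), S.B j n / ((n : ℝ) - (j : ℕ)))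
      atTop (𝓝 0))
    (hsum : Tendsto (fun n => ∑ j ∈ Finset.Icc (a n) (b n),
      Real.exp (-(S.B j n ^ 2 / (10 * ((n : ℝ) - j))))) atTop (𝓝 0)) {K : ℝ} (hK : 0 < K) :
    ∀ᶠ n : ℕ in atTop, ∀ j ∈ Set.Icc (a n) (b n), K ≤ S.B j n := by
  filter_upwards [S.B_div_le_eventually hN1 (ε := 10 / K) (by positivity),
    hsum.eventually_lt_const (Real.exp_pos (-1)), hab, eventually_ge_atTop 2]
    with n h1 h2 h3 hn j hj
  have hm : (0 : ℝ) < n - j := sub_pos.2 (by exact_mod_cast hj.2.trans_lt h3.2.2)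
  have h4 : Real.exp (-(S.B j n ^ 2 / (10 * ((n : ℝ) - j)))) < Real.exp (-1) :=
    (Finset.single_le_sum (f := fun j : ℕ => Real.exp (-(S.B j n ^ 2 / (10 * ((n : ℝ) - j)))))
      (fun _ _ => (Real.exp_pos _).le) (Finset.mem_Icc.2 hj)).trans_lt h2
  have h5 := Real.exp_lt_exp.1 h4
  have h6 : 1 < S.B j n ^ 2 / (10 * ((n : ℝ) - j)) := by linarith
  rw [lt_div_iff₀ (by positivity)] at h6
  have h7 := h1 j hj
  rw [div_le_div_iff₀ hm hK] at h7
  have h8 := S.B_nonneg hn j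
  by_contra! h9
  nlinarith

theorem exists_near_minimizer_eventually (ha : Tendsto a atTop atTop)
    (hB : ∀ᶠ n : ℕ in atTop, ∀ j ∈ Set.Icc (a n) (b n), 1 ≤ S.B j n)
    (hN3 : S.CondN3 a b) {η : ℝ} (hη : 0 < η) :
    ∀ᶠ n : ℕ in atTop, ∀ k : Γ n, a n ≤ S.rk n k → S.rk n k ≤ b n → ∃ k' ∈ S.S₁ n k,
      ‖S.proj n k (S.fvec n) - S.proj n k' (S.fvec n)‖ ^ 2 ≤ η * S.D n k := by
  filter_upwards [hN3.eventually_lt_const hη, hB, ha.eventually_ge_atTop 2,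
    eventually_ge_atTop 2] with n h1 h2 h3 hn k hka hkb
  have hD : ∀ k : {k : Γ n // a n ≤ S.rk n k ∧ S.rk n k ≤ b n}, 1 ≤ S.D n k := fun k =>
    (h2 _ k.2).trans (S.B_le_D hn k)
  have hne : ∀ k : {k : Γ n // a n ≤ S.rk n k ∧ S.rk n k ≤ b n}, (S.S₁ n k).Nonempty := fun k =>
    S.subModels_nonempty n k (lt_of_lt_of_le (by omega) k.2.1)
  have hbdd : ∀ k : {k : Γ n // a n ≤ S.rk n k ∧ S.rk n k ≤ b n},
      BddBelow (Set.range fun k' : S.S₁ n k =>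
        ‖S.proj n k (S.fvec n) - S.proj n k' (S.fvec n)‖ ^ 2) := by
    rintro k
    refine ⟨0, ?_⟩
    rintro _ ⟨k', rfl⟩
    exact sq_nonneg _
  -- An unbounded real supremum is zero by convention, so boundedness must be shown before the limit
  -- says anything about single models; `‖f‖²` works because `D ≥ 1`.
  have h4 := (le_ciSup (f := fun k : {k : Γ n // a n ≤ S.rk n k ∧ S.rk n k ≤ b n} =>
    (⨅ k' : S.S₁ n k, ‖S.proj n k (S.fvec n) - S.proj n k' (S.fvec n)‖ ^ 2) / S.D n k)
    ⟨‖S.fvec n‖ ^ 2, ?_⟩ ⟨k, hka, hkb⟩).trans_lt h1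
  · rw [div_lt_iff₀ (zero_lt_one.trans_le (hD ⟨k, hka, hkb⟩))] at h4
    have : Nonempty (S.S₁ n k) := (hne ⟨k, hka, hkb⟩).to_subtype
    obtain ⟨k', hk'⟩ := exists_lt_of_ciInf_lt h4
    exact ⟨k', k'.2, hk'.le⟩
  · rintro _ ⟨k, rfl⟩
    obtain ⟨k', hk'⟩ := hne k
    refine div_le_of_le_mul₀ (zero_le_one.trans (hD k)) (sq_nonneg _) ?_
    refine ((ciInf_le (hbdd k) ⟨k', hk'⟩).trans ?_).trans
      (le_mul_of_one_le_right (sq_nonneg _) (hD k))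
    gcongr
    exact (norm_starProjection_sub_le (S.col_le hk') _).trans
      (Submodule.norm_starProjection_apply_le _ _)

theorem tendstoInMeasure_PI [IsProbabilityMeasure P] [∀ n, Countable (Γ n)]
    (hab : ∀ᶠ n in atTop, 1 ≤ a n ∧ a n < b n ∧ b n < n) (ha : Tendsto a atTop atTop)
    (hN1 : S.CondN1 a b) (hN2 : S.CondN2 a b) (hN3 : S.CondN3 a b) :
    TendstoInMeasure P S.PI atTop (fun _ => (1 : ℝ)) := by
  rw [tendstoInMeasure_iff_norm]
  intro ε hε
  obtain ⟨hsel, hsup⟩ := hN1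
  obtain ⟨⟨ζ, c₀, -, hζ, hc₀, hcard⟩, hsum⟩ := hN2
  have hσ := S.sigma_pos
  set δ := ε / 100 with hδdef
  have hδ : 0 < δ := by positivity
  set γ := min (1 / 3200) (δ / 4)
  have hγ : 0 < γ := lt_min (by norm_num) (by positivity)
  have hnear := S.exists_near_minimizer_eventually ha
    (S.le_B_eventually hab hsup hsum one_pos) hN3 (η := S.sigma ^ 2 * δ) (by positivity)
  classical
  -- One deterministic submodel per candidate, so the union runs over `k` alone. The fallback `k` is
  -- irrelevant for ranks in the window once `n` is large.
  let sub : (n : ℕ) → Γ n → Γ n := fun n k =>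
    if h : ∃ k' ∈ S.S₁ n k, ‖S.proj n k (S.fvec n) - S.proj n k' (S.fvec n)‖ ^ 2
      ≤ S.sigma ^ 2 * δ * S.D n k then h.choose else k
  have hsub : ∀ᶠ n : ℕ in atTop, ∀ k : Γ n, a n ≤ S.rk n k → S.rk n k ≤ b n →
      sub n k ∈ S.S₁ n k ∧ ‖S.proj n k (S.fvec n) - S.proj n (sub n k) (S.fvec n)‖ ^ 2
        ≤ S.sigma ^ 2 * δ * S.D n k := by
    filter_upwards [hnear] with n hn k hk1 hk2
    have h := hn k hk1 hk2
    simp only [sub, dif_pos h]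
    exact h.choose_spec
  have hselbad : Tendsto (fun n => P {ω | a n ≤ S.rk n (S.selected n ω) ∧
      S.rk n (S.selected n ω) ≤ b n}ᶜ) atTop (𝓝 0) := by
    refine tendsto_measure_compl (fun n => ?_) hsel
    have : {ω | a n ≤ S.rk n (S.selected n ω) ∧ S.rk n (S.selected n ω) ≤ b n}
        = ⋃ k ∈ {k : Γ n | a n ≤ S.rk n k ∧ S.rk n k ≤ b n}, {ω | S.selected n ω = k} := by
      ext ω
      simp
    rw [this]
    exact MeasurableSet.biUnion (Set.to_countable _) fun k _ => S.selected_measurable n k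
  have hbad : Tendsto (fun n => P (⋃ j ∈ Finset.Icc (a n) (b n),
      ⋃ k ∈ {k : Γ n | S.rk n k = j}, S.badEvent δ n k (sub n k))) atTop (𝓝 0) := by
    have hlim : Tendsto (fun n => ENNReal.ofReal (4 * c₀ * ∑ j ∈ Finset.Icc (a n) (b n),
        Real.exp (-(S.B j n ^ 2 / (10 * ((n : ℝ) - j)))))) atTop (𝓝 0) := by
      have := ENNReal.tendsto_ofReal (hsum.const_mul (4 * c₀))
      simpa using this
    refine tendsto_of_tendsto_of_tendsto_of_le_of_le' tendsto_const_nhds hlim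
      (Eventually.of_forall fun _ => zero_le) ?_
    filter_upwards [hab, hcard, hsub, S.B_div_le_eventually hsup (ε := 5 * γ) (by positivity),
      S.le_B_eventually hab hsup hsum one_pos, hζ.eventually_lt_const (half_pos hγ),
      ha.eventually_ge_atTop 2, eventually_ge_atTop 2]
      with n habn hcardn hsubn hBm hB hζn han hn
    refine (measure_biUnion_finset_le _ _).trans ?_
    rw [Finset.mul_sum, ENNReal.ofReal_sum_of_nonneg fun _ _ => by positivity]
    refine Finset.sum_le_sum fun j hj => ?_
    have hj' := Finset.mem_Icc.1 hj
    exact S.measure_iUnion_badEvent_le hc₀ (min_le_left _ _) (min_le_right _ _) hζn.le hn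
      (by omega) (by omega)
      (fun k hk => (hsubn k (hk ▸ hj'.1) (hk ▸ hj'.2)).1)
      (zero_lt_one.trans_le (hB j hj')) (hBm j hj') (hcardn j hj').1 (hcardn j hj').2
  refine tendsto_of_tendsto_of_tendsto_of_le_of_le' tendsto_const_nhds
    (tendsto_measure_union hselbad hbad) (Eventually.of_forall fun _ => zero_le) ?_
  filter_upwards [hsub, S.le_B_eventually hab hsup hsum (K := max 1 (2 / δ)) (by positivity),
    ha.eventually_ge_atTop (max 2 ⌈2 / δ⌉₊), eventually_ge_atTop 2] with n hsubn hB han hn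
  refine measure_mono fun ω hω => ?_
  by_contra hgood
  simp only [Set.mem_union, Set.mem_compl_iff, Set.mem_iUnion, not_or, not_not, not_exists] at hgood
  obtain ⟨hrank, hgood⟩ := hgood
  have hrank' : a n ≤ S.rk n (S.selected n ω) ∧ S.rk n (S.selected n ω) ≤ b n := hrank
  set k := S.selected n ω with hk
  have hgoodk := hgood (S.rk n k) (Finset.mem_Icc.2 hrank') k rfl
  obtain ⟨hk1, hk2⟩ := hsubn k hrank'.1 hrank'.2
  have hBk := (hB _ hrank').trans (S.B_le_D hn k)
  have hD1 : 1 ≤ S.D n k := (le_max_left _ _).trans hBk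
  have hD2 : 2 / δ ≤ S.D n k := (le_max_right _ _).trans hBk
  have hr2 : 2 / δ ≤ S.rk n k := by
    have h1 : ⌈2 / δ⌉₊ ≤ S.rk n k := ((le_max_right _ _).trans han).trans hrank'.1
    exact (Nat.le_ceil _).trans (by exact_mod_cast h1)
  have hr1 : 1 < S.rk n k := by
    have := (le_max_left _ _).trans (han.trans hrank'.1)
    omega
  have hl := S.one_le_lam_mul_log hn
  -- If `λ log n ≤ 2`, use `D ≥ 2/δ`. Otherwise `λ log n ≤ 2(λ log n - 1) ≤ δ r (λ log n - 1) ≤ δ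
  -- D`, using that the rank is at least `2/δ`.
  have hlD : S.lam n * Real.log n ≤ δ * S.D n k := by
    rw [div_le_iff₀ hδ] at hD2 hr2
    rcases le_or_gt (S.lam n * Real.log n) 2 with h | h
    · linarith
    · have h1 := mul_le_mul_of_nonneg_left (S.penalty_le_D k) hδ.le
      have h2 := mul_le_mul_of_nonneg_left hr2 (sub_nonneg.2 hl)
      linarith
  have := S.abs_PI_sub_one_le hδ.le hr1 hk1 (by linarith) (by linarith) hlD hk2 hgoodk
  have hω' : ε ≤ |S.PI n ω - 1| := hω
  linarith

end Nonparametric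

end Setting

end ParamIndex

end

open ParamIndex in
theorem mainTheorem4 {Ω : Type*} [MeasurableSpace Ω] (P : Measure Ω) [IsProbabilityMeasure P]
    {𝒳 : Type*} {Γ : ℕ → Type*} [∀ n, Countable (Γ n)] (S : Setting P 𝒳 Γ)
    (hsize : ∃ κ : (n : ℕ) → Γ n,
      Tendsto (fun n => Module.finrank ℝ (S.model n (κ n))) atTop atTop) :
    (∀ kstar : (n : ℕ) → Γ n, S.Parametric kstar → S.SelectionConsistent kstar →
      (∃ τ : ℝ, 0 < τ ∧ τ ≤ 1 / 2 ∧ S.CondP1 kstar τ ∧ S.CondP2 kstar τ) →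
        TendstoInProbAtTop P (fun n ω => |S.PI n ω|) ∧
        (Tendsto (fun n : ℕ => ((S.lam n * Real.log n - 1) * S.rk n (kstar n)
            + S.d * Real.sqrt n * Real.log n) / Real.sqrt n) atTop atTop →
          TendstoInProbAtTop P S.PI) ∧
        (0 < S.d → TendstoInProbAtTop P S.PI) ∧
        ((∀ᶠ n : ℕ in atTop, 1 < S.lam n * Real.log n ∨ 0 < S.d) →
          TendstoInProbAtTop P S.PIhat)) ∧
    (S.Nonparametric →
      (∃ a b : ℕ → ℕ, (∀ᶠ n in atTop, 1 ≤ a n ∧ a n < b n ∧ b n < n) ∧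
        Tendsto a atTop atTop ∧ S.CondN1 a b ∧ S.CondN2 a b ∧ S.CondN3 a b) →
      TendstoInMeasure P S.PI atTop (fun _ => (1 : ℝ))) := by
  refine ⟨?_, ?_⟩
  · rintro kstar hpar hsel ⟨τ, hτ, hτ2, hP1, hP2⟩
    exact ⟨S.tendstoInProb_abs_PI hpar hsel hτ hτ2 hP1 hP2,
      S.tendstoInProb_PI hpar hsel hτ hP1 hP2,
      fun hd => S.tendstoInProb_PI hpar hsel hτ hP1 hP2 (S.tendsto_penalty_of_d_pos hd kstar),
      S.tendstoInProb_PIhat hpar hsel hτ hτ2 hP1 hP2⟩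
  · rintro - ⟨a, b, hab, ha, hN1, hN2, hN3⟩
    exact S.tendstoInMeasure_PI hab ha hN1 hN2 hN3
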